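/- Let $F$ be a distribution function on $\mathbb R$ with finite second moment, mean $\mu_F$ and standard deviation $\sigma_F>0$. Write $G^{-1}(u)=\inf\{y: G(y)\ge u\}$ and $G^{-1,+}(u)=\inf\{y: G(y)>u\}$, $0<u<1$. Let $\mu\in\mathbb R$, $\sigma>0$, $0<\alpha<1$, $\varepsilon\in\mathbb R$, and let $\mathcal M_\varepsilon(\mu,\sigma)$ be the set of distribution functions $G$ with mean $\mu$, second moment $\mu^2+\sigma^2$ and $d_W(F,G)\le\sqrt\varepsilon$, where $d_W$ is the Wasserstein distance of order 2. Put $\mathrm{VaR}_\alpha(G)=G^{-1}(\alpha)$ and $\mathrm{VaR}^+_\alpha(G)=G^{-1,+}(\alpha)$. Let $U$ be uniform on $(0,1)$, $c_0=\mathrm{corr}(F^{-1}(U),\mathbf 1_{\{U\in(\alpha,1)\}})$, and assume $$(\mu_F-\mu)^2+(\sigma_F-\sigma)^2<\varepsilon<(\mu_F-\mu)^2+(\sigma_F-\sigma)^2+2\sigma\sigma_F(1-c_0).$$ **Worst case.** There are $\lambda>0$, $w_1\in(\alpha,1]$ and $c\in\mathbb R$ with $$c=\frac{1}{w_1-\alpha}+\frac{\lambda}{w_1-\alpha}\int_\alpha^{w_1}F^{-1}(u)\,du,\qquad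 \lambda F^{-1}(u)\le c\ \text{ for }\alpha<u\le w_1,\ u<1,\qquad \lambda F^{-1}(u)\ge c\ \text{ for }w_1<u<1,$$ such that, with $k(u)=c$ for $\alpha<u\le w_1$ and $k(u)=\lambda F^{-1}(u)$ for all other $u\in(0,1)$, the function $$h(u)=\mu+\sigma\,\frac{k(u)-\mathbb E[k(U)]}{\mathrm{std}(k(U))},\qquad 0<u<1,$$ is the quantile function of the unique maximiser of $\mathrm{VaR}^+_\alpha$ over $\mathcal M_\varepsilon(\mu,\sigma)$; moreover $\lambda$ is the unique positive number for which $h$ satisfies $d_W(F^{-1},h)=\sqrt\varepsilon$. For all $\beta>\alpha$ sufficiently close to $\alpha$, these $w_1,c$ together with $w_0=\alpha$ satisfy the conditions defining the worst-case quantile of $\mathrm{RVaR}_{\alpha,\beta}$, namely $\alpha\le w_0\le\beta\le w_1\le 1$, $$c\,(w_1-w_0)=\frac{\beta-w_0}{\beta-\alpha}+\lambda\int_{w_0}^{w_1}F^{-1}(u)\,du,$$ the level $c$ crosses $\frac1{\beta-\alpha}+\lambda F^{-1}$ at $w_0$ (that is, $\frac1{\beta-\alpha}+\lambda F^{-1}\le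 c$ on $(\alpha,w_0]$ and $\ge c$ on $(w_0,\beta]$) and crosses $\lambda F^{-1}$ at $w_1$ (that is, $\lambda F^{-1}\le c$ on $(w_0,w_1]$ and $\ge c$ on $(w_1,1)$), all inequalities being understood at points of $(0,1)$; and $k$ is the associated RVaR function, equal to $\lambda F^{-1}$ on $(0,\alpha]$, $\frac1{\beta-\alpha}+\lambda F^{-1}$ on $(\alpha,w_0]$, $c$ on $(w_0,w_1]$ and $\lambda F^{-1}$ on $(w_1,1)$. Furthermore, $\sup_{G\in\mathcal M_\varepsilon(\mu,\sigma)}\mathrm{VaR}_\alpha(G)=\max_{G\in\mathcal M_\varepsilon(\mu,\sigma)}\mathrm{VaR}^+_\alpha(G)$, and this supremum is not attained by $\mathrm{VaR}_\alpha$. **Best case.** There are $\lambda>0$, $z_0\in[0,\alpha)$ and $c\in\mathbb R$ with $$c=-\frac{1}{\alpha-z_0}+\frac{\lambda}{\alpha-z_0}\int_{z_0}^{\alpha}F^{-1}(u)\,du,\qquad \lambda F^{-1}(u)\le c\ \text{ for }0<u\le z_0,\qquad \lambda F^{-1}(u)\ge c\ \text{ for }z_0<u\le\alpha,$$ such that,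 with $k(u)=-c$ for $z_0<u\le\alpha$ and $k(u)=-\lambda F^{-1}(u)$ for all other $u\in(0,1)$, the function $$h(u)=\mu+\sigma\,\frac{\mathbb E[k(U)]-k(u)}{\mathrm{std}(k(U))},\qquad 0<u<1,$$ is the quantile function of the unique minimiser of $\mathrm{VaR}_\alpha$ over $\mathcal M_\varepsilon(\mu,\sigma)$; moreover $\lambda$ is the unique positive number for which $h$ satisfies $d_W(F^{-1},h)=\sqrt\varepsilon$. For all $a<\alpha$ sufficiently close to $\alpha$, these $z_0,c$ together with $z_1=\alpha$ satisfy the conditions defining the best-case quantile of $\mathrm{RVaR}_{a,\beta}$ with upper level $\beta=\alpha$, namely $0\le z_0\le a\le z_1\le\beta$, $$c\,(z_1-z_0)=-\frac{z_1-a}{\beta-a}+\lambda\int_{z_0}^{z_1}F^{-1}(u)\,du,$$ $\lambda F^{-1}\le c$ on $(0,z_0]$ and $\ge c$ on $(z_0,z_1]$, and $\lambda F^{-1}-\frac1{\beta-a}\le c$ on $(a,z_1]$ and $\ge c$ on $(z_1,\beta]$; and $k$ is the associated RVaR function, equal to $-\lambda F^{-1}$ on $(0,z_0]$, $-c$ on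 $(z_0,z_1]$, $-\lambda F^{-1}+\frac1{\beta-a}$ on $(z_1,\beta]$ and $-\lambda F^{-1}$ on $(\beta,1)$. Furthermore, $\inf_{G\in\mathcal M_\varepsilon(\mu,\sigma)}\mathrm{VaR}^+_\alpha(G)=\min_{G\in\mathcal M_\varepsilon(\mu,\sigma)}\mathrm{VaR}_\alpha(G)$, and this infimum is not attained by $\mathrm{VaR}^+_\alpha$. -/

import Mathlib

open MeasureTheory Set

namespace VaRBounds

/-- The (left-continuous) quantile function `G⁻¹(u) = inf {y | G(y) ≥ u}`, `0 < u < 1`, of the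
distribution `G`; a distribution on `ℝ` is represented by its law, whose distribution function is
`ProbabilityTheory.cdf G`. -/
noncomputable def quantile (G : Measure ℝ) (u : ℝ) : ℝ :=
  sInf {y : ℝ | u ≤ ProbabilityTheory.cdf G y}

/-- The right-continuous inverse `G^{-1,+}(u) = inf {y | G(y) > u}`, `0 < u < 1`. -/
noncomputable def quantilePlus (G : Measure ℝ) (u : ℝ) : ℝ :=
  sInf {y : ℝ | u < ProbabilityTheory.cdf G y}

/-- `VaR_α(G) = G⁻¹(α)`. -/
noncomputable def VaR (α : ℝ) (G : Measure ℝ) : ℝ := quantile G α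

/-- `VaR⁺_α(G) = G^{-1,+}(α)`. -/
noncomputable def VaRPlus (α : ℝ) (G : Measure ℝ) : ℝ := quantilePlus G α

/-- The bivariate distributions with marginals `G₁` and `G₂`. -/
def couplings (G₁ G₂ : Measure ℝ) : Set (Measure (ℝ × ℝ)) :=
  {π | π.fst = G₁ ∧ π.snd = G₂}

/-- The Wasserstein distance of order 2 between two distributions with finite second moment:
the infimum of `E[(X₁ - X₂)²]^{1/2}` over all couplings of the two distributions. -/
noncomputable def dW (G₁ G₂ : Measure ℝ) : ℝ :=
  sInf ((fun π : Measure (ℝ × ℝ) => √(∫ p, (p.1 - p.2) ^ 2 ∂π)) '' couplings G₁ G₂)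

/-- The uncertainty set `M_ε(μ, σ)` around the reference distribution `F`. -/
def uncertaintySet (F : Measure ℝ) (μ σ ε : ℝ) : Set (Measure ℝ) :=
  {G | IsProbabilityMeasure G ∧ MemLp id 2 G ∧ ∫ x, x ∂G = μ ∧ ∫ x, x ^ 2 ∂G = μ ^ 2 + σ ^ 2 ∧
    dW F G ≤ √ε}

/-- The law of a standard uniform random variable `U` on `(0,1)`. -/
noncomputable def unif : Measure ℝ := volume.restrict (Ioo 0 1)

/-- `E(f(U))`. -/
noncomputable def meanU (f : ℝ → ℝ) : ℝ := ∫ u, f u ∂unif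

/-- `std(f(U))`. -/
noncomputable def stdU (f : ℝ → ℝ) : ℝ := √(ProbabilityTheory.variance f unif)

/-- `corr(f(U), g(U))`. -/
noncomputable def corrU (f g : ℝ → ℝ) : ℝ :=
  ProbabilityTheory.covariance f g unif / (stdU f * stdU g)

/-- `h↑ = μ + σ (k - E k(U)) / std k(U)`. -/
noncomputable def hUp (μ σ : ℝ) (k : ℝ → ℝ) (u : ℝ) : ℝ :=
  μ + σ * ((k u - meanU k) / stdU k)

/-- `h↓ = μ + σ (E k(U) - k) / std k(U)`. -/
noncomputable def hDown (μ σ : ℝ) (k : ℝ → ℝ) (u : ℝ) : ℝ :=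
  μ + σ * ((meanU k - k u) / stdU k)

/-- The function `k↑_λ` of the worst-case quantile of `RVaR_{α,β}`, for the reference quantile
function `q = F⁻¹`. -/
noncomputable def rvarWorst (q : ℝ → ℝ) (α β lam w₀ w₁ c : ℝ) (u : ℝ) : ℝ :=
  if u ≤ α then lam * q u
  else if u ≤ w₀ then 1 / (β - α) + lam * q u
  else if u ≤ w₁ then c
  else lam * q u

/-- The conditions on the parameters `w₀, w₁, c` of the worst-case quantile of `RVaR_{α,β}`.
The level `c` crosses `1/(β-α) + λ q` at `w₀` (with `w₀ = α` if the jump `1/(β-α)` is too large)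
and crosses `λ q` at `w₁` (with `w₁ = 1` if `c` dominates `λ q`). Crossings are written as
inequalities, since `q` may jump across the level; where `q` is continuous they are the equations
`1/(β-α) + λ q(w₀) = c` and `λ q(w₁) = c`. -/
structure IsRVaRWorstParams (q : ℝ → ℝ) (α β lam w₀ w₁ c : ℝ) : Prop where
  left_le : α ≤ w₀
  le_beta : w₀ ≤ β
  beta_le : β ≤ w₁
  le_one : w₁ ≤ 1
  before_w₀ : ∀ u ∈ Ioo (0 : ℝ) 1, α < u → u ≤ w₀ → 1 / (β - α) + lam * q u ≤ c
  after_w₀ : ∀ u ∈ Ioo (0 : ℝ) 1, w₀ < u → u ≤ β → c ≤ 1 / (β - α) + lam * q u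
  before_w₁ : ∀ u ∈ Ioo (0 : ℝ) 1, w₀ < u → u ≤ w₁ → lam * q u ≤ c
  after_w₁ : ∀ u ∈ Ioo (0 : ℝ) 1, w₁ < u → c ≤ lam * q u
  c_eq : c * (w₁ - w₀) = (β - w₀) / (β - α) + lam * ∫ u in w₀..w₁, q u

/-- The function `k↓_λ` of the best-case quantile of `RVaR_{α,β}`, for the reference quantile
function `q = F⁻¹`. -/
noncomputable def rvarBest (q : ℝ → ℝ) (α β lam z₀ z₁ c : ℝ) (u : ℝ) : ℝ :=
  if u ≤ z₀ then -(lam * q u)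
  else if u ≤ z₁ then -c
  else if u ≤ β then -(lam * q u) + 1 / (β - α)
  else -(lam * q u)

/-- The conditions on the parameters `z₀, z₁, c` of the best-case quantile of `RVaR_{α,β}`:
the level `c` crosses `λ q` at `z₀` (with `z₀ = 0` if `c` is below `λ q`) and crosses
`λ q - 1/(β-α)` at `z₁` (with `z₁ = β` if the jump `1/(β-α)` is too large). -/
structure IsRVaRBestParams (q : ℝ → ℝ) (α β lam z₀ z₁ c : ℝ) : Prop where
  zero_le : 0 ≤ z₀
  le_alpha : z₀ ≤ α
  alpha_le : α ≤ z₁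
  le_beta : z₁ ≤ β
  before_z₀ : ∀ u ∈ Ioo (0 : ℝ) 1, u ≤ z₀ → lam * q u ≤ c
  after_z₀ : ∀ u ∈ Ioo (0 : ℝ) 1, z₀ < u → u ≤ z₁ → c ≤ lam * q u
  before_z₁ : ∀ u ∈ Ioo (0 : ℝ) 1, α < u → u ≤ z₁ → lam * q u - 1 / (β - α) ≤ c
  after_z₁ : ∀ u ∈ Ioo (0 : ℝ) 1, z₁ < u → u ≤ β → c ≤ lam * q u - 1 / (β - α)
  c_eq : c * (z₁ - z₀) = -((z₁ - α) / (β - α)) + lam * ∫ u in z₀..z₁, q u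

end VaRBounds

/-! Write `q` for the quantile function of `F`. The comonotone coupling is optimal for the quadratic
cost, so `dW F G` is the L² distance of the quantile functions (`dW_eq`). Once mean and variance of
`G` are fixed, the Wasserstein ball becomes a covariance constraint cov(q, G⁻¹) ≥ Rσ with 2Rσ =
(μF-μ)² + σF² + σ² - ε. The lower bound on ε says R < σF; the upper bound says that the indicator of
the upper tail violates the constraint: cov(1, q) < R·std(1).

What remains is a problem in L²: among g with mean μ, variance σ² and cov(p, g) ≥ Rσ, maximise an
essential lower bound v of g on a set A. The worst case is p = q, A = (α,∞); the best case is p =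
-q, A = (-∞,α]. Let e = (c - λp)₊ on A and 0 elsewhere, normalised to mean 1, and K = λp + e. Then v
≤ E[eg] = μ + cov(K, g) - λ cov(p, g) ≤ μ + σ(std K - λR) by Cauchy–Schwarz. If cov(K, p) = R·std K,
the standardised K attains the bound, because K = c wherever e > 0, and equality in Cauchy–Schwarz
leaves no other maximiser (`le_level_of_le_on`).

Suitable λ, c come from an intermediate value argument on a path from p to the indicator of A
(`exists_isOptimalLift`). Two solutions have the same standardisation, and this forces the same
slope (`IsOptimalLift.unique`).

Since `VaR` ≤ `VaRPlus`, the supremum of `VaR` is at most the maximum of `VaRPlus`. It is approached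
by lifting on slightly larger sets (α - 1/n, ∞), using slack in the constraint just before the end
of the path. It is not attained: the law would have to be the unique maximiser, whose quantile
function at α itself still lies below the raised level. The best case is the mirror image. -/

namespace VaRBounds

open ProbabilityTheory Filter Topology

/-! ### Raised functions: moments, continuity, and the duality bound. -/

section Lifted

variable {Ω : Type*} {p g : Ω → ℝ} {A : Set Ω} {lam c m₀ R : ℝ}

/-- The amount by which `lam * p` has to be raised on `A` to reach the level `c`. -/
noncomputable def excess (p : Ω → ℝ) (A : Set Ω) (lam c : ℝ) : Ω → ℝ :=
  A.indicator fun ω => max (c - lam * p ω) 0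

/-- The function `lam * p`, raised to the level `c` on `A` where it is below `c`. -/
noncomputable def lifted (p : Ω → ℝ) (A : Set Ω) (lam c : ℝ) (ω : Ω) : ℝ :=
  lam * p ω + excess p A lam c ω

lemma lifted_of_notMem {ω : Ω} (h : ω ∉ A) : lifted p A lam c ω = lam * p ω := by
  simp [lifted, excess, h]

lemma lifted_of_mem {ω : Ω} (h : ω ∈ A) : lifted p A lam c ω = max c (lam * p ω) := by
  simp only [lifted, excess, indicator_of_mem h]
  rcases le_total c (lam * p ω) with h | h
  · rw [max_eq_right (by linarith), max_eq_right h]; ring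
  · rw [max_eq_left (by linarith), max_eq_left h]; ring

lemma excess_nonneg (ω : Ω) : 0 ≤ excess p A lam c ω :=
  indicator_nonneg (fun _ _ => le_max_right _ _) ω

lemma abs_lifted_le (ω : Ω) : |lifted p A lam c ω| ≤ |lam| * |p ω| + |c| := by
  rw [← abs_mul]
  by_cases h : ω ∈ A
  · rw [lifted_of_mem h]
    refine abs_max_le_max_abs_abs.trans (max_le ?_ ?_) <;>
      linarith [abs_nonneg c, abs_nonneg (lam * p ω)]
  · rw [lifted_of_notMem h]
    linarith [abs_nonneg c]

/-- Raising a multiple of `lifted` scales both parameters. -/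
lemma lifted_mul {s : ℝ} (hs : 0 ≤ s) (ω : Ω) :
    lifted p A (s * lam) (s * c) ω = s * lifted p A lam c ω := by
  by_cases h : ω ∈ A
  · rw [lifted_of_mem h, lifted_of_mem h, mul_max_of_nonneg _ _ hs, mul_assoc]
  · rw [lifted_of_notMem h, lifted_of_notMem h, mul_assoc]

lemma excess_mul {s : ℝ} (hs : 0 ≤ s) (ω : Ω) :
    excess p A (s * lam) (s * c) ω = s * excess p A lam c ω := by
  have := lifted_mul (p := p) (A := A) (lam := lam) (c := c) hs ω
  simp only [lifted] at this
  linarith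

/-- Complementary slackness: where the excess is nonzero, the lifted function sits exactly at `c`.
-/
lemma excess_mul_lifted (ω : Ω) :
    excess p A lam c ω * lifted p A lam c ω = excess p A lam c ω * c := by
  by_cases hA : ω ∈ A
  · rcases le_total c (lam * p ω) with h | h
    · simp [excess, h]
    · rw [lifted_of_mem hA, max_eq_left h]
  · simp [excess, hA]

variable [MeasurableSpace Ω] {P : Measure Ω}

/-- If the level is exceeded on a set of positive measure, the excess has positive mean. -/
lemma exists_lt_of_integral_excess_pos (hpos : 0 < ∫ ω, excess p A lam c ω ∂P) :
    ∃ᵐ ω ∂P, ω ∈ A ∧ lam * p ω < c := by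
  intro h
  have : excess p A lam c =ᵐ[P] 0 := by
    filter_upwards [h] with ω hω
    by_cases hA : ω ∈ A
    · have : ¬ lam * p ω < c := fun h' => hω ⟨hA, h'⟩
      simp only [excess, indicator_of_mem hA, Pi.zero_apply]
      exact max_eq_right (by linarith)
    · simp [excess, hA]
  rw [integral_congr_ae this] at hpos
  simp at hpos

lemma lt_of_integral_excess_pos (hlam : 0 ≤ lam) (hm : ∀ᵐ ω ∂P, ω ∈ A → m₀ ≤ p ω)
    (hpos : 0 < ∫ ω, excess p A lam c ω ∂P) : lam * m₀ < c := by
  obtain ⟨ω, ⟨hA, h⟩, hω⟩ := ((exists_lt_of_integral_excess_pos hpos).and_eventually hm).exists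
  exact (mul_le_mul_of_nonneg_left (hω hA) hlam).trans_lt h

variable [IsProbabilityMeasure P]

lemma memLp_lifted (hp : MemLp p 2 P) (hA : MeasurableSet A) : MemLp (lifted p A lam c) 2 P := by
  have h1 : MemLp (fun ω => lam * p ω) 2 P := hp.const_mul lam
  have h2 : MemLp (fun ω => |lam| * |p ω| + |c|) 2 P :=
    (hp.abs.const_mul |lam|).add (memLp_const |c|)
  refine h2.mono' ?_ (ae_of_all _ fun ω => abs_lifted_le ω)
  have h3 : AEStronglyMeasurable (fun ω => max (c - lam * p ω) 0) P := by
    have := h1.aestronglyMeasurable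
    fun_prop
  exact h1.aestronglyMeasurable.add (h3.indicator hA)

lemma memLp_excess (hp : MemLp p 2 P) (hA : MeasurableSet A) : MemLp (excess p A lam c) 2 P := by
  refine ((memLp_lifted (lam := lam) (c := c) hp hA).sub (hp.const_mul lam)).ae_eq
    (ae_of_all _ fun ω => ?_)
  simp [lifted]

lemma integrable_excess (hp : MemLp p 2 P) (hA : MeasurableSet A) :
    Integrable (excess p A lam c) P :=
  (memLp_excess hp hA).integrable one_le_two

/-- Dominated convergence for mean, variance and covariance of square-integrable functions. -/
lemma tendsto_moments {ι : Type*} {l : Filter ι} [l.IsCountablyGenerated] {f : ι → Ω → ℝ}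
    {f₀ b : Ω → ℝ} (hp : MemLp p 2 P) (hf : ∀ i, MemLp (f i) 2 P) (hf₀ : MemLp f₀ 2 P)
    (hb : MemLp b 2 P) (hfb : ∀ᶠ i in l, ∀ ω, |f i ω| ≤ b ω)
    (hlim : ∀ᵐ ω ∂P, Tendsto (fun i => f i ω) l (𝓝 (f₀ ω))) :
    Tendsto (fun i => ∫ ω, f i ω ∂P) l (𝓝 (∫ ω, f₀ ω ∂P)) ∧
      Tendsto (fun i => Var[f i; P]) l (𝓝 (Var[f₀; P])) ∧
      Tendsto (fun i => cov[f i, p; P]) l (𝓝 (cov[f₀, p; P])) := by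
  have hmean : Tendsto (fun i => ∫ ω, f i ω ∂P) l (𝓝 (∫ ω, f₀ ω ∂P)) :=
    tendsto_integral_filter_of_dominated_convergence b
      (Eventually.of_forall fun i => (hf i).aestronglyMeasurable)
      (hfb.mono fun i hi => ae_of_all _ hi) (hb.integrable one_le_two) hlim
  refine ⟨hmean, ?_, ?_⟩
  · simp_rw [fun i => variance_eq_sub (hf i), variance_eq_sub hf₀]
    refine Tendsto.sub ?_ (hmean.pow 2)
    refine tendsto_integral_filter_of_dominated_convergence (fun ω => b ω ^ 2)
      (Eventually.of_forall fun i => (hf i).aestronglyMeasurable.pow 2)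
      (hfb.mono fun i hi => ae_of_all _ fun ω => ?_) hb.integrable_sq
      (hlim.mono fun ω h => h.pow 2)
    simp only [Pi.pow_apply, norm_pow, Real.norm_eq_abs]
    exact pow_le_pow_left₀ (abs_nonneg _) (hi ω) 2
  · simp_rw [fun i => covariance_eq_sub (hf i) hp, covariance_eq_sub hf₀ hp]
    refine Tendsto.sub ?_ (hmean.mul_const _)
    refine tendsto_integral_filter_of_dominated_convergence (fun ω => b ω * |p ω|)
      (Eventually.of_forall fun i => (hf i).aestronglyMeasurable.mul hp.aestronglyMeasurable)
      (hfb.mono fun i hi => ae_of_all _ fun ω => ?_) (hb.integrable_mul hp.abs)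
      (hlim.mono fun ω h => h.mul_const _)
    simp only [Pi.mul_apply, norm_mul, Real.norm_eq_abs]
    exact mul_le_mul_of_nonneg_right (hi ω) (abs_nonneg _)

/-- Serves two purposes: continuity along a path of parameters with `A` fixed, and stability under
sets `B i` tending to `A` with the parameters fixed. -/
lemma tendsto_lifted_moments {ι : Type*} {l : Filter ι} [l.IsCountablyGenerated]
    (hp : MemLp p 2 P) {B : ι → Set Ω} (hA : MeasurableSet A) (hB : ∀ i, MeasurableSet (B i))
    (hBA : ∀ᵐ ω ∂P, ∀ᶠ i in l, (ω ∈ B i ↔ ω ∈ A)) {a d : ι → ℝ}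
    (ha : Tendsto a l (𝓝 lam)) (hd : Tendsto d l (𝓝 c)) :
    Tendsto (fun i => ∫ ω, lifted p (B i) (a i) (d i) ω ∂P) l
        (𝓝 (∫ ω, lifted p A lam c ω ∂P)) ∧
      Tendsto (fun i => Var[lifted p (B i) (a i) (d i); P]) l (𝓝 (Var[lifted p A lam c; P])) ∧
      Tendsto (fun i => cov[lifted p (B i) (a i) (d i), p; P]) l
        (𝓝 (cov[lifted p A lam c, p; P])) := by
  refine tendsto_moments (b := fun ω => (|lam| + 1) * |p ω| + (|c| + 1)) hp
    (fun i => memLp_lifted hp (hB i)) (memLp_lifted hp hA)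
    ((hp.abs.const_mul _).add (memLp_const _)) ?_ ?_
  · filter_upwards [ha.abs.eventually_le_const (lt_add_one _),
      hd.abs.eventually_le_const (lt_add_one _)] with i h1 h2 ω
    exact (abs_lifted_le ω).trans
      (add_le_add (mul_le_mul_of_nonneg_right h1 (abs_nonneg _)) h2)
  · filter_upwards [hBA] with ω h
    by_cases hω : ω ∈ A
    · rw [lifted_of_mem hω]
      refine (hd.max (ha.mul_const (p ω))).congr' (h.mono fun i hi => ?_)
      exact (lifted_of_mem (hi.2 hω)).symm
    · rw [lifted_of_notMem hω]
      refine (ha.mul_const (p ω)).congr' (h.mono fun i hi => ?_)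
      exact (lifted_of_notMem fun h' => hω (hi.1 h')).symm

/-- The lifted function equals `c > lam * m₀` on a non-null part of `A` but is at most `lam * m₀`
off `A`, so it is not almost surely constant. -/
lemma variance_lifted_pos (hp : MemLp p 2 P) (hA : MeasurableSet A) (hlam : 0 ≤ lam)
    (hm : ∀ᵐ ω ∂P, ω ∈ A → m₀ ≤ p ω) (hm' : ∀ᵐ ω ∂P, ω ∉ A → p ω ≤ m₀)
    (hA' : ∃ᵐ ω ∂P, ω ∉ A) (hpos : 0 < ∫ ω, excess p A lam c ω ∂P) :
    0 < Var[lifted p A lam c; P] := by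
  refine (variance_nonneg _ _).lt_of_ne fun h => ?_
  have hae := ae_eq_integral_of_variance_eq_zero (memLp_lifted hp hA) h.symm
  obtain ⟨ω, ⟨h1, h2⟩, h3⟩ := (exists_lt_of_integral_excess_pos hpos |>.and_eventually hae).exists
  obtain ⟨ω', h1', h2', h3'⟩ := (hA'.and_eventually (hae.and hm')).exists
  rw [lifted_of_mem h1, max_eq_left h2.le] at h3
  rw [lifted_of_notMem h1', ← h3] at h2'
  have := lt_of_integral_excess_pos hlam hm hpos
  have := mul_le_mul_of_nonneg_left (h3' h1') hlam
  linarith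

lemma covariance_lifted (hp : MemLp p 2 P) (hA : MeasurableSet A) (hg : MemLp g 2 P) :
    cov[lifted p A lam c, g; P] = lam * cov[p, g; P] + cov[excess p A lam c, g; P] := by
  rw [← covariance_const_mul_left]
  exact covariance_add_left (hp.const_mul lam) (memLp_excess hp hA) hg

/-- The standardised level equals the standard deviation minus a covariance term. -/
lemma level_sub_integral (hp : MemLp p 2 P) (hA : MeasurableSet A)
    (h1 : ∫ ω, excess p A lam c ω ∂P = 1) :
    c - ∫ ω, lifted p A lam c ω ∂P =
      Var[lifted p A lam c; P] - lam * cov[lifted p A lam c, p; P] := by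
  have hK := memLp_lifted (lam := lam) (c := c) hp hA
  have h := covariance_lifted (lam := lam) (c := c) hp hA hK
  rw [covariance_self hK.aemeasurable, covariance_comm p,
    covariance_eq_sub (memLp_excess hp hA) hK, h1] at h
  have h2 : ∫ ω, (excess p A lam c * lifted p A lam c) ω ∂P = c := by
    simp only [Pi.mul_apply, excess_mul_lifted]
    rw [integral_mul_const, h1, one_mul]
  rw [h2] at h
  linarith

/-- Cauchy–Schwarz for the covariance, with the case of equality. -/
lemma covariance_le_and_eq {k g : Ω → ℝ} (hk : MemLp k 2 P) (hg : MemLp g 2 P)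
    (hkv : 0 < Var[k; P]) {σ : ℝ} (hσ : 0 < σ) (hgv : Var[g; P] = σ ^ 2) :
    cov[k, g; P] ≤ √Var[k; P] * σ ∧ (√Var[k; P] * σ ≤ cov[k, g; P] →
      ∀ᵐ ω ∂P, g ω = ∫ ω, g ω ∂P + σ * ((k ω - ∫ ω, k ω ∂P) / √Var[k; P])) := by
  set s := √Var[k; P] with hs
  have hs0 : 0 < s := Real.sqrt_pos.2 hkv
  have hs2 : Var[k; P] = s ^ 2 := (Real.sq_sqrt hkv.le).symm
  have hk' : MemLp (fun ω => σ / s * k ω) 2 P := hk.const_mul _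
  -- The variance of this residual is a positive multiple of the Cauchy–Schwarz gap, which gives
  -- both the inequality and the case of equality.
  have hv : Var[fun ω => g ω - σ / s * k ω; P] = 2 * σ / s * (s * σ - cov[k, g; P]) := by
    rw [variance_fun_sub hg hk', variance_const_mul, covariance_const_mul_right, hgv, hs2,
      covariance_comm g k]
    field_simp
    ring
  constructor
  · by_contra! h
    have : 2 * σ / s * (s * σ - cov[k, g; P]) < 0 :=
      mul_neg_of_pos_of_neg (by positivity) (by linarith)
    linarith [variance_nonneg (fun ω => g ω - σ / s * k ω) P]
  · intro h
    have h0 : Var[fun ω => g ω - σ / s * k ω; P] = 0 := by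
      refine le_antisymm ?_ (variance_nonneg _ _)
      rw [hv]
      exact mul_nonpos_of_nonneg_of_nonpos (by positivity) (by linarith)
    filter_upwards [ae_eq_integral_of_variance_eq_zero (hg.sub hk') h0] with ω hω
    rw [integral_sub' (hg.integrable one_le_two) (hk'.integrable one_le_two),
      integral_const_mul, Pi.sub_apply] at hω
    field_simp
    field_simp at hω
    linarith

/-- Optimality of the standardised lifted function: among square-integrable functions with given
mean and variance whose covariance with `p` is large enough, none has an essential lower bound on
`A` which exceeds the standardised level; and only one reaches it. -/
lemma le_level_of_le_on (hp : MemLp p 2 P) (hA : MeasurableSet A) (hlam : 0 ≤ lam)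
    (h1 : ∫ ω, excess p A lam c ω ∂P = 1) (hv : 0 < Var[lifted p A lam c; P])
    (hcov : cov[lifted p A lam c, p; P] = R * √Var[lifted p A lam c; P])
    {μ σ v : ℝ} (hσ : 0 < σ) (hg : MemLp g 2 P) (hgm : ∫ ω, g ω ∂P = μ)
    (hgv : Var[g; P] = σ ^ 2) (hgc : R * σ ≤ cov[p, g; P]) (hvg : ∀ᵐ ω ∂P, ω ∈ A → v ≤ g ω) :
    v ≤ μ + σ * ((c - ∫ ω, lifted p A lam c ω ∂P) / √Var[lifted p A lam c; P]) ∧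
    (v = μ + σ * ((c - ∫ ω, lifted p A lam c ω ∂P) / √Var[lifted p A lam c; P]) →
      ∀ᵐ ω ∂P, g ω = μ + σ * ((lifted p A lam c ω - ∫ ω, lifted p A lam c ω ∂P) /
        √Var[lifted p A lam c; P])) := by
  have hK := memLp_lifted (lam := lam) (c := c) hp hA
  have hE := memLp_excess (lam := lam) (c := c) hp hA
  obtain ⟨hcs, heq⟩ := covariance_le_and_eq hK hg hv hσ hgv
  have hlev := level_sub_integral hp hA h1
  have hs0 := Real.sqrt_pos.2 hv
  have hs2 := Real.sq_sqrt hv.le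
  set s := √Var[lifted p A lam c; P]
  have hval : σ * ((c - ∫ ω, lifted p A lam c ω ∂P) / s) = σ * (s - lam * R) := by
    rw [hlev, hcov, ← hs2]
    field_simp
  have hcE := covariance_lifted (lam := lam) (c := c) hp hA hg
  rw [covariance_eq_sub hE hg, h1, hgm] at hcE
  -- The excess is a probability density carried by `A`, so the average of `g` against it is at
  -- least `v`.
  have hvE : v ≤ ∫ ω, (excess p A lam c * g) ω ∂P := by
    have : v = ∫ ω, excess p A lam c ω * v ∂P := by rw [integral_mul_const, h1, one_mul]
    rw [this]
    refine integral_mono_ae ((integrable_excess hp hA).mul_const v) (hE.integrable_mul hg) ?_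
    filter_upwards [hvg] with ω hω
    by_cases h : ω ∈ A
    · exact mul_le_mul_of_nonneg_left (hω h) (excess_nonneg ω)
    · simp [excess, h]
  have hlc := mul_le_mul_of_nonneg_left hgc hlam
  rw [hval]
  rw [hgm] at heq
  constructor
  · linarith
  · intro h
    exact heq (by linarith)

end Lifted

/-! ### Existence and uniqueness of the optimal lift. -/

section OptimalLift

variable {Ω : Type*} [MeasurableSpace Ω] {P : Measure Ω} {p : Ω → ℝ} {A : Set Ω}
  {lam c m₀ R : ℝ}

/-- The parameters of a lifted function whose standardisation has covariance `R` with `p`. -/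
structure IsOptimalLift (P : Measure Ω) (p : Ω → ℝ) (A : Set Ω) (R lam c : ℝ) : Prop where
  pos : 0 < lam
  integral_excess : ∫ ω, excess p A lam c ω ∂P = 1
  variance_pos : 0 < Var[lifted p A lam c; P]
  covariance_eq : cov[lifted p A lam c, p; P] = R * √Var[lifted p A lam c; P]


lemma covariance_congr_left {X X' Y : Ω → ℝ} (h : X =ᵐ[P] X') : cov[X, Y; P] = cov[X', Y; P] := by
  simp only [covariance, integral_congr_ae h]
  refine integral_congr_ae ?_
  filter_upwards [h] with ω hω
  rw [hω]

/-- A positive excess can be normalised by rescaling both parameters. -/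
lemma isOptimalLift_rescale (hlam : 0 < lam)
    (hE : 0 < ∫ ω, excess p A lam c ω ∂P) (hv : 0 < Var[lifted p A lam c; P])
    (hcov : cov[lifted p A lam c, p; P] = R * √Var[lifted p A lam c; P]) :
    ∃ lam' c', IsOptimalLift P p A R lam' c' ∧
      (c' - ∫ ω, lifted p A lam' c' ω ∂P) / √Var[lifted p A lam' c'; P] =
        (c - ∫ ω, lifted p A lam c ω ∂P) / √Var[lifted p A lam c; P] := by
  set s := (∫ ω, excess p A lam c ω ∂P)⁻¹ with hs
  have hs0 : 0 < s := inv_pos.2 hE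
  have hl : lifted p A (s * lam) (s * c) = fun ω => s * lifted p A lam c ω :=
    funext fun ω => lifted_mul hs0.le ω
  have hvar : Var[lifted p A (s * lam) (s * c); P] = s ^ 2 * Var[lifted p A lam c; P] := by
    rw [hl, variance_const_mul]
  have hsd : √Var[lifted p A (s * lam) (s * c); P] = s * √Var[lifted p A lam c; P] := by
    rw [hvar, Real.sqrt_mul (sq_nonneg s), Real.sqrt_sq hs0.le]
  refine ⟨s * lam, s * c, ⟨mul_pos hs0 hlam, ?_, ?_, ?_⟩, ?_⟩
  · simp_rw [excess_mul hs0.le]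
    rw [integral_const_mul, hs, inv_mul_cancel₀ hE.ne']
  · rw [hvar]; positivity
  · rw [hsd, hl, covariance_const_mul_left, hcov]; ring
  · rw [hsd, hl, integral_const_mul, ← mul_sub, mul_div_mul_left _ _ hs0.ne']

variable [IsProbabilityMeasure P]

/-- The moments of a function after an affine change of its mean and standard deviation. -/
lemma standardise_moments {k g : Ω → ℝ} (hk : MemLp k 2 P) (hv : 0 < Var[k; P]) {μ σ : ℝ}
    (hg : ∀ ω, g ω = μ + σ * ((k ω - ∫ ω, k ω ∂P) / √Var[k; P])) :
    MemLp g 2 P ∧ ∫ ω, g ω ∂P = μ ∧ Var[g; P] = σ ^ 2 ∧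
      cov[p, g; P] = σ * (cov[k, p; P] / √Var[k; P]) := by
  obtain ⟨s, hs⟩ : ∃ s, s = √Var[k; P] := ⟨_, rfl⟩
  obtain ⟨m, hm⟩ : ∃ m, m = ∫ ω, k ω ∂P := ⟨_, rfl⟩
  have hs0 : 0 < s := hs ▸ Real.sqrt_pos.2 hv
  have hs2 : Var[k; P] = s ^ 2 := by rw [hs, Real.sq_sqrt hv.le]
  rw [← hs, ← hm] at hg
  rw [← hs]
  have hK' : MemLp (fun ω => σ / s * k ω) 2 P := hk.const_mul _
  obtain rfl : g = fun ω => (μ - σ / s * m) + σ / s * k ω := by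
    ext ω
    rw [hg]
    ring
  have hc : MemLp (fun _ : Ω => μ - σ / s * m) 2 P := memLp_const _
  refine ⟨hc.add hK', ?_, ?_, ?_⟩
  · rw [integral_add (integrable_const _) (hK'.integrable one_le_two), integral_const_mul, ← hm]
    simp
  · rw [variance_const_add hK'.aestronglyMeasurable, variance_const_mul, hs2, div_pow,
      div_mul_cancel₀ _ (pow_ne_zero 2 hs0.ne')]
  · rw [covariance_const_add_right (hK'.integrable one_le_two), covariance_const_mul_right,
      covariance_comm, div_mul_eq_mul_div, mul_div_assoc]

/-- Existence of the optimal lift; its standardised level is approached by the levels of admissible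
functions which are lifted on sets converging to `A`. -/
theorem exists_isOptimalLift (hp : MemLp p 2 P) (hA : MeasurableSet A)
    (hm : ∀ᵐ ω ∂P, ω ∈ A → m₀ ≤ p ω) (hm' : ∀ᵐ ω ∂P, ω ∉ A → p ω ≤ m₀)
    (hA' : ∃ᵐ ω ∂P, ω ∉ A) (hpv : 0 < Var[p; P]) (hR : R < √Var[p; P])
    (hR' : cov[A.indicator fun _ => (1 : ℝ), p; P] <
      R * √Var[A.indicator fun _ => (1 : ℝ); P]) :
    ∃ lam c, IsOptimalLift P p A R lam c ∧
      ∀ B : ℕ → Set Ω, (∀ n, MeasurableSet (B n)) →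
        (∀ᵐ ω ∂P, ∀ᶠ n in atTop, (ω ∈ B n ↔ ω ∈ A)) →
        ∀ v < (c - ∫ ω, lifted p A lam c ω ∂P) / √Var[lifted p A lam c; P],
          ∃ n lam' c', 0 ≤ lam' ∧ 0 < Var[lifted p (B n) lam' c'; P] ∧
            R * √Var[lifted p (B n) lam' c'; P] ≤ cov[lifted p (B n) lam' c', p; P] ∧
            v < (c' - ∫ ω, lifted p (B n) lam' c' ω ∂P) / √Var[lifted p (B n) lam' c'; P] := by
  -- The path joins `p` at `t = 0`, where the level `m₀` raises nothing, to the indicator of `A` at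
  -- `t = 1`. Normalising the excess is postponed to `isOptimalLift_rescale`.
  set K : ℝ → Ω → ℝ := fun t => lifted p A (1 - t) ((1 - t) * m₀ + t) with hK
  set φ : ℝ → ℝ := fun t => cov[K t, p; P] - R * √Var[K t; P] with hφ
  have hmom := fun t₀ : ℝ => tendsto_lifted_moments (B := fun _ : ℝ => A) (l := 𝓝 t₀)
    (a := fun t => 1 - t) (d := fun t => (1 - t) * m₀ + t) (lam := 1 - t₀)
    (c := (1 - t₀) * m₀ + t₀) hp hA (fun _ => hA) (by simp)
    (Continuous.tendsto (by fun_prop) t₀) (Continuous.tendsto (by fun_prop) t₀)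
  have hφc : Continuous φ := continuous_iff_continuousAt.2 fun t₀ =>
    (hmom t₀).2.2.sub ((hmom t₀).2.1.sqrt.const_mul R)
  have hφ0 : 0 < φ 0 := by
    have : K 0 =ᵐ[P] p := by
      filter_upwards [hm] with ω hω
      by_cases h : ω ∈ A
      · simp [hK, lifted_of_mem h, hω h]
      · simp [hK, lifted_of_notMem h]
    simp only [hφ]
    rw [variance_congr this, covariance_congr_left this,
      covariance_self hp.aemeasurable]
    have h2 := Real.mul_self_sqrt hpv.le
    have h3 := mul_pos (sub_pos.2 hR) (Real.sqrt_pos.2 hpv)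
    rw [sub_mul, h2] at h3
    exact h3
  have hφ1 : φ 1 < 0 := by
    have : K 1 = A.indicator fun _ => (1 : ℝ) := by
      ext ω
      by_cases h : ω ∈ A
      · simp [hK, lifted_of_mem h, h]
      · simp [hK, lifted_of_notMem h, h]
    simp only [hφ, this]
    linarith
  -- The first zero is taken, not just any zero: `φ > 0` before it, and this slack is what the
  -- approximation by `B n` uses.
  set S := {t | t ∈ Icc (0 : ℝ) 1 ∧ φ t ≤ 0} with hS
  have hScl : IsClosed S := isClosed_Icc.inter (isClosed_le hφc continuous_const)
  have hSne : S.Nonempty := ⟨1, by simp, hφ1.le⟩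
  have hSbdd : BddBelow S := ⟨0, fun t ht => ht.1.1⟩
  set T := sInf S with hT
  have hTS : T ∈ S := hScl.csInf_mem hSne hSbdd
  have hbelow : ∀ t, 0 ≤ t → t < T → 0 < φ t := fun t h0 ht => by
    by_contra! h
    exact absurd (csInf_le hSbdd ⟨⟨h0, ht.le.trans hTS.1.2⟩, h⟩) (not_le.2 ht)
  have hT0 : 0 < T := hTS.1.1.lt_of_ne fun h => by
    have := hTS.2
    rw [← h] at this
    linarith
  have hφT : φ T = 0 := by
    refine le_antisymm hTS.2 ?_
    refine ge_of_tendsto (hφc.tendsto T |>.mono_left (nhdsWithin_le_nhds (s := Iio T))) ?_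
    filter_upwards [Ioo_mem_nhdsLT hT0] with t ht
    exact (hbelow t ht.1.le ht.2).le
  have hT1 : T < 1 := hTS.1.2.lt_of_ne fun h => by
    rw [h] at hφT
    linarith
  -- Without excess, `K T` would be `(1 - T) * p`, and `φ T` would be (1 - T)·std p·(std p - R) > 0.
  have hE : 0 < ∫ ω, excess p A (1 - T) ((1 - T) * m₀ + T) ω ∂P := by
    refine (integral_nonneg fun ω => excess_nonneg ω).lt_of_ne fun h => ?_
    have h0 := (integral_eq_zero_iff_of_nonneg (fun ω => excess_nonneg ω)
      (integrable_excess hp hA)).1 h.symm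
    have hKp : K T =ᵐ[P] fun ω => (1 - T) * p ω := by
      filter_upwards [h0] with ω hω
      simp only [hK, lifted, hω, Pi.zero_apply, add_zero]
    have hT1' : 0 < 1 - T := by linarith
    simp only [hφ] at hφT
    rw [variance_congr hKp, covariance_congr_left hKp, covariance_const_mul_left,
      variance_const_mul, Real.sqrt_mul (sq_nonneg _), Real.sqrt_sq hT1'.le,
      covariance_self hp.aemeasurable] at hφT
    have h2 := Real.mul_self_sqrt hpv.le
    have h3 : 0 < (1 - T) * (√Var[p; P] * (√Var[p; P] - R)) :=
      mul_pos hT1' (mul_pos (Real.sqrt_pos.2 hpv) (sub_pos.2 hR))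
    have h4 : (1 - T) * (√Var[p; P] * (√Var[p; P] - R)) =
      (1 - T) * (√Var[p; P] * √Var[p; P]) - R * ((1 - T) * √Var[p; P]) := by ring
    rw [h4, h2] at h3
    linarith
  have hv : 0 < Var[K T; P] :=
    variance_lifted_pos hp hA (by linarith) hm hm' hA' hE
  obtain ⟨lam, c, hopt, hlev⟩ := isOptimalLift_rescale (R := R) (by linarith : 0 < 1 - T) hE hv
    (by simpa [hφ, sub_eq_zero] using hφT)
  refine ⟨lam, c, hopt, fun B hB hBA v hvlt => ?_⟩
  rw [hlev] at hvlt
  have hlevT : Tendsto (fun t => (((1 - t) * m₀ + t) - ∫ ω, K t ω ∂P) / √Var[K t; P]) (𝓝 T)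
      (𝓝 ((((1 - T) * m₀ + T) - ∫ ω, K T ω ∂P) / √Var[K T; P])) :=
    ((Continuous.tendsto (by fun_prop) T).sub (hmom T).1).div (hmom T).2.1.sqrt
      (Real.sqrt_pos.2 hv).ne'
  -- Slightly before `T` the standardised level still exceeds `v` and the constraint is strict; both
  -- strict inequalities survive replacing `A` by `B n` for large `n`.
  obtain ⟨t, ⟨ht0, htT⟩, htlev, htv⟩ : ∃ t, t ∈ Ioo 0 T ∧
      v < (((1 - t) * m₀ + t) - ∫ ω, K t ω ∂P) / √Var[K t; P] ∧ 0 < Var[K t; P] := by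
    have h1 := (hlevT.eventually_const_lt hvlt).and ((hmom T).2.1.eventually_const_lt hv)
    have h2 : ∀ᶠ t in 𝓝[<] T, t ∈ Ioo 0 T := Ioo_mem_nhdsLT hT0
    exact (h2.and (h1.filter_mono nhdsWithin_le_nhds)).exists
  have hφt := hbelow t ht0.le htT
  obtain ⟨l1, l2, l3⟩ := tendsto_lifted_moments (l := atTop) (a := fun _ : ℕ => 1 - t)
    (d := fun _ => (1 - t) * m₀ + t) hp hA hB hBA tendsto_const_nhds tendsto_const_nhds
  have l4 := ((tendsto_const_nhds (x := (1 - t) * m₀ + t)).sub l1).div l2.sqrt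
    (Real.sqrt_pos.2 htv).ne'
  have l5 := l3.sub (l2.sqrt.const_mul R)
  obtain ⟨n, n1, n2, n3⟩ := ((l4.eventually_const_lt htlev).and
    ((l2.eventually_const_lt htv).and (l5.eventually_const_lt hφt))).exists
  exact ⟨n, 1 - t, _, by linarith, n2, by linarith, n1⟩

/-- If the inequality failed, comparison off `A` would make `p` a constant `q₀ ≤ m₀` there, and
comparison on `A` would make the second lift constantly `c'` on `A`. That lift would be affine in
the indicator of `A`, so its covariance equation would contradict the strict inequality `hR'`. -/
lemma mul_le_of_lifted_affine (hA : MeasurableSet A)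
    (hm : ∀ᵐ ω ∂P, ω ∈ A → m₀ ≤ p ω) (hm' : ∀ᵐ ω ∂P, ω ∉ A → p ω ≤ m₀)
    (hA' : ∃ᵐ ω ∂P, ω ∉ A)
    (hR' : cov[A.indicator fun _ => (1 : ℝ), p; P] <
      R * √Var[A.indicator fun _ => (1 : ℝ); P])
    {lam' c' a b : ℝ} (h : IsOptimalLift P p A R lam c) (h' : IsOptimalLift P p A R lam' c')
    (ha : 0 < a)
    (hab : ∀ᵐ ω ∂P, lifted p A lam' c' ω = a * lifted p A lam c ω + b) : a * lam ≤ lam' := by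
  by_contra! hlt
  set d := a * lam - lam' with hd
  have hd0 : 0 < d := by linarith
  set q₀ := -b / d with hq
  have hdq : d * q₀ = -b := mul_div_cancel₀ _ hd0.ne'
  have hoff : ∀ᵐ ω ∂P, ω ∉ A → p ω = q₀ := by
    filter_upwards [hab] with ω hω hωA
    rw [lifted_of_notMem hωA, lifted_of_notMem hωA] at hω
    rw [hq, eq_div_iff hd0.ne', hd]
    linarith
  have hqm : q₀ ≤ m₀ := by
    obtain ⟨ω, h1, h2, h3⟩ := (hA'.and_eventually (hoff.and hm')).exists
    rw [← h2 h1]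
    exact h3 h1
  have hpos : 0 < ∫ ω, excess p A lam c ω ∂P := by rw [h.integral_excess]; exact one_pos
  have hpos' : 0 < ∫ ω, excess p A lam' c' ω ∂P := by rw [h'.integral_excess]; exact one_pos
  have hc := lt_of_integral_excess_pos h.pos.le hm hpos
  have hc' := lt_of_integral_excess_pos h'.pos.le hm hpos'
  have hlq : lam * q₀ < c := (mul_le_mul_of_nonneg_left hqm h.pos.le).trans_lt hc
  have hlq' : lam' * q₀ < c' := (mul_le_mul_of_nonneg_left hqm h'.pos.le).trans_lt hc'
  have hcc : c' = a * c + b := by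
    obtain ⟨ω, ⟨h1, h2⟩, h3, h4⟩ :=
      ((exists_lt_of_integral_excess_pos hpos).and_eventually (hab.and hm)).exists
    rw [lifted_of_mem h1, lifted_of_mem h1, max_eq_left h2.le] at h3
    have h5 : d * q₀ ≤ d * p ω := mul_le_mul_of_nonneg_left (hqm.trans (h4 h1)) hd0.le
    have h6 : a * (lam * p ω) < a * c := mul_lt_mul_of_pos_left h2 ha
    have h7 : d * p ω = a * (lam * p ω) - lam' * p ω := by rw [hd]; ring
    rcases max_choice c' (lam' * p ω) with h8 | h8 <;> rw [h8] at h3 <;> linarith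
  have hKae : lifted p A lam' c' =ᵐ[P]
      fun ω => lam' * q₀ + (c' - lam' * q₀) * A.indicator (fun _ => (1 : ℝ)) ω := by
    filter_upwards [hab, hoff] with ω h1 h2
    by_cases hωA : ω ∈ A
    · rw [lifted_of_mem hωA, lifted_of_mem hωA] at h1
      rw [lifted_of_mem hωA, indicator_of_mem hωA]
      rcases max_choice c' (lam' * p ω) with h8 | h8
      · rw [h8]; ring
      · rw [h8] at h1 ⊢
        rcases le_total c (lam * p ω) with h9 | h9
        · rw [max_eq_right h9] at h1
          have h10 : d * p ω = d * q₀ := by rw [hdq, hd]; linarith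
          rw [mul_left_cancel₀ hd0.ne' h10] at h9
          linarith
        · rw [max_eq_left h9, ← hcc] at h1
          linarith
    · rw [lifted_of_notMem hωA, indicator_of_notMem hωA, h2 hωA]
      ring
  have hI : MemLp (A.indicator fun _ => (1 : ℝ)) 2 P := (memLp_const 1).indicator hA
  have hI' : MemLp (fun ω => (c' - lam' * q₀) * A.indicator (fun _ => (1 : ℝ)) ω) 2 P :=
    hI.const_mul _
  have hcov := h'.covariance_eq
  have hcq : 0 < c' - lam' * q₀ := by linarith
  rw [variance_congr hKae, covariance_congr_left hKae,
    variance_const_add hI'.aestronglyMeasurable,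
    covariance_const_add_left (hI'.integrable one_le_two), variance_const_mul,
    covariance_const_mul_left, Real.sqrt_mul (sq_nonneg _), Real.sqrt_sq hcq.le,
    mul_left_comm R] at hcov
  exact absurd (mul_left_cancel₀ hcq.ne' hcov) hR'.ne

/-- The slope of the optimal lift is unique. -/
theorem IsOptimalLift.unique (hp : MemLp p 2 P) (hA : MeasurableSet A)
    (hm : ∀ᵐ ω ∂P, ω ∈ A → m₀ ≤ p ω) (hm' : ∀ᵐ ω ∂P, ω ∉ A → p ω ≤ m₀)
    (hA' : ∃ᵐ ω ∂P, ω ∉ A)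
    (hR' : cov[A.indicator fun _ => (1 : ℝ), p; P] <
      R * √Var[A.indicator fun _ => (1 : ℝ); P])
    {lam' c' : ℝ} (h : IsOptimalLift P p A R lam c) (h' : IsOptimalLift P p A R lam' c') :
    lam' = lam := by
  -- Each standardised lift is an admissible competitor against the other, here with mean 0 and
  -- standard deviation 1. Hence the levels agree, and the equality case identifies the two
  -- functions.
  have key : ∀ {lam c lam' c'}, IsOptimalLift P p A R lam c → IsOptimalLift P p A R lam' c' →
      (0 + 1 * ((c' - ∫ ω, lifted p A lam' c' ω ∂P) / √Var[lifted p A lam' c'; P]) ≤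
        0 + 1 * ((c - ∫ ω, lifted p A lam c ω ∂P) / √Var[lifted p A lam c; P])) ∧
      (0 + 1 * ((c' - ∫ ω, lifted p A lam' c' ω ∂P) / √Var[lifted p A lam' c'; P]) =
        0 + 1 * ((c - ∫ ω, lifted p A lam c ω ∂P) / √Var[lifted p A lam c; P]) →
      ∀ᵐ ω ∂P, 0 + 1 * ((lifted p A lam' c' ω - ∫ ω, lifted p A lam' c' ω ∂P) /
          √Var[lifted p A lam' c'; P]) =
        0 + 1 * ((lifted p A lam c ω - ∫ ω, lifted p A lam c ω ∂P) /
          √Var[lifted p A lam c; P])) := by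
    intro lam c lam' c' h h'
    obtain ⟨g1, g2, g3, g4⟩ := standardise_moments (p := p) (μ := 0) (σ := 1)
      (memLp_lifted hp hA) h'.variance_pos (fun _ => rfl)
    have hs := Real.sqrt_pos.2 h'.variance_pos
    rw [h'.covariance_eq, mul_div_cancel_right₀ _ hs.ne', mul_comm] at g4
    refine le_level_of_le_on hp hA h.pos.le h.integral_excess h.variance_pos h.covariance_eq
      one_pos g1 g2 g3 g4.ge (ae_of_all _ fun ω hω => ?_)
    rw [lifted_of_mem hω]
    gcongr
    exact le_max_left _ _
  have heq := le_antisymm (key h h').1 (key h' h).1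
  have hs := Real.sqrt_pos.2 h.variance_pos
  have hs' := Real.sqrt_pos.2 h'.variance_pos
  have hae := (key h h').2 heq
  set s := √Var[lifted p A lam c; P]
  set s' := √Var[lifted p A lam' c'; P]
  set m := ∫ ω, lifted p A lam c ω ∂P
  set m' := ∫ ω, lifted p A lam' c' ω ∂P
  have hab : ∀ᵐ ω ∂P, lifted p A lam' c' ω = s' / s * lifted p A lam c ω + (m' - s' / s * m) := by
    filter_upwards [hae] with ω hω
    field_simp at hω ⊢
    linarith
  have hba : ∀ᵐ ω ∂P, lifted p A lam c ω = s / s' * lifted p A lam' c' ω + (m - s / s' * m') := by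
    filter_upwards [hae] with ω hω
    field_simp at hω ⊢
    linarith
  have i1 := mul_le_of_lifted_affine hA hm hm' hA' hR' h h' (div_pos hs' hs) hab
  have i2 := mul_le_of_lifted_affine hA hm hm' hA' hR' h' h (div_pos hs hs') hba
  set a := s' / s with ha
  have ha0 : 0 < a := div_pos hs' hs
  -- The two slope inequalities give proportional slopes, a point off `A` shows that the affine
  -- relation has no shift, and equal mean excess forces `a = 1`.
  have hal : lam' = a * lam := by
    refine le_antisymm ?_ i1
    have : s / s' = a⁻¹ := by rw [ha, inv_div]
    rw [this, inv_mul_le_iff₀ ha0] at i2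
    exact i2
  have hb : m' - a * m = 0 := by
    obtain ⟨ω, h1, h2⟩ := (hA'.and_eventually hab).exists
    rw [lifted_of_notMem h1, lifted_of_notMem h1, hal] at h2
    linarith
  have hEx : ∫ ω, excess p A lam' c' ω ∂P = a * ∫ ω, excess p A lam c ω ∂P := by
    rw [← integral_const_mul]
    refine integral_congr_ae ?_
    filter_upwards [hab] with ω hω
    simp only [lifted, hb, hal] at hω ⊢
    linarith
  rw [h.integral_excess, h'.integral_excess] at hEx
  rw [hal, ← mul_one a, ← hEx, one_mul]

end OptimalLift

/-! ### Quantile functions and laws of functions of a uniform variable. -/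

section Quantile

instance : IsProbabilityMeasure unif := ⟨by simp [unif]⟩

lemma ae_unif_mem : ∀ᵐ u ∂unif, u ∈ Ioo (0 : ℝ) 1 := ae_restrict_mem measurableSet_Ioo

lemma unif_Ioc {a b : ℝ} (ha : 0 ≤ a) (hb : b ≤ 1) : unif (Ioc a b) = ENNReal.ofReal (b - a) := by
  rw [unif, Measure.restrict_congr_set Ioo_ae_eq_Ioc, Measure.restrict_apply measurableSet_Ioc,
    inter_eq_left.2 (Ioc_subset_Ioc ha hb), Real.volume_Ioc]

lemma unif_Iic {a : ℝ} (ha1 : a ≤ 1) : unif (Iic a) = ENNReal.ofReal a := by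
  rw [unif, Measure.restrict_congr_set Ioo_ae_eq_Ioc, Measure.restrict_apply measurableSet_Iic,
    inter_comm, Ioc_inter_Iic, inf_eq_right.2 ha1, Real.volume_Ioc, sub_zero]

variable {G : Measure ℝ} {u y α : ℝ}

lemma exists_lt_cdf (hu : u < 1) : ∃ y, u < cdf G y :=
  ((tendsto_cdf_atTop G).eventually_const_lt hu).exists

lemma bddBelow_le_cdf (hu : 0 < u) : BddBelow {y | u ≤ cdf G y} := by
  obtain ⟨y, hy⟩ := ((tendsto_cdf_atBot G).eventually_lt_const hu).exists
  refine ⟨y, fun z hz => ?_⟩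
  by_contra! h
  exact absurd (hz.trans (monotone_cdf G h.le)) (not_le.2 hy)

lemma bddBelow_lt_cdf (hu : 0 < u) : BddBelow {y | u < cdf G y} :=
  (bddBelow_le_cdf hu).mono (ofPred_subset_ofPred.2 fun _ => le_of_lt)

/-- The Galois connection between the quantile function and the distribution function. -/
lemma quantile_le_iff (hu : u ∈ Ioo (0 : ℝ) 1) : quantile G u ≤ y ↔ u ≤ cdf G y := by
  have hne : {y | u ≤ cdf G y}.Nonempty := (exists_lt_cdf hu.2).imp fun _ h => h.le
  -- Right-continuity of the distribution function makes the infimum a minimum.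
  have hmem : u ≤ cdf G (quantile G u) := by
    have hc := (cdf G).right_continuous (quantile G u)
    refine ge_of_tendsto (hc.mono_left (nhdsWithin_mono _ Ioi_subset_Ici_self)) ?_
    filter_upwards [self_mem_nhdsWithin] with z hz
    obtain ⟨x, hx, hxz⟩ := exists_lt_of_csInf_lt hne hz
    exact le_trans hx (monotone_cdf G hxz.le)
  exact ⟨fun h => hmem.trans (monotone_cdf G h), fun h => csInf_le (bddBelow_le_cdf hu.1) h⟩

lemma monotoneOn_quantile : MonotoneOn (quantile G) (Ioo 0 1) := fun _ hu _ hv huv =>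
  (quantile_le_iff hu).2 (huv.trans ((quantile_le_iff hv).1 le_rfl))

/-- The quantile function is left-continuous. -/
lemma exists_lt_quantile (hu : u ∈ Ioo (0 : ℝ) 1) (hy : y < quantile G u) :
    ∃ v ∈ Ioo 0 u, y < quantile G v := by
  have h : cdf G y < u := not_le.1 fun h => absurd ((quantile_le_iff hu).2 h) (not_le.2 hy)
  obtain ⟨v, hv1, hv2⟩ := exists_between h
  have hv0 : 0 < v := (cdf_nonneg G y).trans_lt hv1
  exact ⟨v, ⟨hv0, hv2⟩,
    not_le.1 fun h' => absurd ((quantile_le_iff ⟨hv0, hv2.trans hu.2⟩).1 h') (not_le.2 hv1)⟩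

lemma aemeasurable_of_monotoneOn {h : ℝ → ℝ} (hh : MonotoneOn h (Ioo 0 1)) : AEMeasurable h unif :=
  aemeasurable_restrict_of_monotoneOn measurableSet_Ioo hh

lemma aemeasurable_quantile : AEMeasurable (quantile G) unif :=
  aemeasurable_of_monotoneOn monotoneOn_quantile

lemma quantilePlus_le_quantile (hα : 0 < α) (hu : u < 1) (hαu : α < u) :
    quantilePlus G α ≤ quantile G u := by
  refine csInf_le (bddBelow_lt_cdf hα) ?_
  exact hαu.trans_le ((quantile_le_iff ⟨hα.trans hαu, hu⟩).1 le_rfl)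

lemma le_quantilePlus (hα : α ∈ Ioo (0 : ℝ) 1) {v b : ℝ} (hb : α < b)
    (hv : ∀ u ∈ Ioo (0 : ℝ) 1, α < u → u ≤ b → v ≤ quantile G u) : v ≤ quantilePlus G α := by
  refine le_csInf (exists_lt_cdf hα.2) fun y hy => ?_
  obtain ⟨w, hw1, hw2⟩ := exists_between (lt_min (lt_min hb hy) hα.2)
  have hw : w ∈ Ioo (0 : ℝ) 1 := ⟨hα.1.trans hw1, hw2.trans_le (min_le_right _ _)⟩
  have hw3 := hw2.trans_le (min_le_left _ _)
  exact (hv w hw hw1 (hw3.le.trans (min_le_left _ _))).trans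
    ((quantile_le_iff hw).2 (hw3.le.trans (min_le_right _ _)))

lemma quantile_le_quantilePlus (hα : α ∈ Ioo (0 : ℝ) 1) : quantile G α ≤ quantilePlus G α :=
  le_quantilePlus hα hα.2 fun _ hu h _ => monotoneOn_quantile hα hu h.le

variable [IsProbabilityMeasure G]

lemma map_quantile : unif.map (quantile G) = G := by
  have := Measure.isProbabilityMeasure_map (aemeasurable_quantile (G := G))
  refine Measure.ext_of_Iic _ _ fun y => ?_
  rw [Measure.map_apply_of_aemeasurable aemeasurable_quantile measurableSet_Iic, ← ofReal_cdf,
    ← unif_Iic (cdf_le_one G y)]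
  refine measure_congr ?_
  filter_upwards [ae_unif_mem] with u hu
  exact propext (quantile_le_iff hu)

lemma eq_map_of_quantile_ae_eq {h : ℝ → ℝ} (hh : ∀ᵐ u ∂unif, quantile G u = h u) :
    G = unif.map h := by
  rw [← Measure.map_congr hh, map_quantile]

/-- A nondecreasing left-continuous function is the quantile function of its law. -/
lemma quantile_map {h : ℝ → ℝ} (hm : MonotoneOn h (Ioo 0 1))
    (hl : ∀ u ∈ Ioo (0 : ℝ) 1, ∀ y < h u, ∃ v ∈ Ioo 0 u, y < h v) (hu : u ∈ Ioo (0 : ℝ) 1) :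
    quantile (unif.map h) u = h u := by
  have hmeas := aemeasurable_of_monotoneOn hm
  have := Measure.isProbabilityMeasure_map hmeas
  refine eq_of_forall_ge_iff fun y => ?_
  rw [quantile_le_iff hu, cdf_eq_real, measureReal_def,
    Measure.map_apply_of_aemeasurable hmeas measurableSet_Iic,
    ← ENNReal.ofReal_le_iff_le_toReal (measure_ne_top _ _)]
  constructor
  · intro h1
    by_contra! h2
    obtain ⟨v, hv, hyv⟩ := hl u hu y h2
    have h3 : unif (h ⁻¹' Iic y) ≤ unif (Iic v) := by
      refine measure_mono_ae ?_
      filter_upwards [ae_unif_mem] with w hw hwy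
      by_contra h4
      exact absurd ((hm ⟨hv.1, hv.2.trans hu.2⟩ hw (not_le.1 h4).le).trans hwy) (not_le.2 hyv)
    rw [unif_Iic (hv.2.trans hu.2).le] at h3
    exact absurd (h1.trans h3) (not_le.2 ((ENNReal.ofReal_lt_ofReal_iff hu.1).2 hv.2))
  · intro h1
    rw [← unif_Iic hu.2.le]
    refine measure_mono_ae ?_
    filter_upwards [ae_unif_mem] with w hw hwu
    exact (hm hw hu hwu).trans h1

/-- A lower bound of a function on `(a, 1)` with `a < α` is one for the `α`-quantile of its law. -/
lemma le_quantile_map {h : ℝ → ℝ} (hm : AEMeasurable h unif) (hα : α ∈ Ioo (0 : ℝ) 1) {a v : ℝ}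
    (ha : a < α) (hv : ∀ u ∈ Ioo (0 : ℝ) 1, a < u → v ≤ h u) : v ≤ quantile (unif.map h) α := by
  have := Measure.isProbabilityMeasure_map hm
  have h1 := (quantile_le_iff (G := unif.map h) hα).1 le_rfl
  by_contra! h2
  rw [cdf_eq_real, measureReal_def, Measure.map_apply_of_aemeasurable hm measurableSet_Iic,
    ← ENNReal.ofReal_le_iff_le_toReal (measure_ne_top _ _)] at h1
  have h3 : unif (h ⁻¹' Iic (quantile (unif.map h) α)) ≤ unif (Iic a) := by
    refine measure_mono_ae ?_
    filter_upwards [ae_unif_mem] with w hw hwy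
    by_contra h4
    exact absurd ((hv w hw (not_le.1 h4)).trans hwy) (not_le.2 h2)
  rw [unif_Iic (ha.trans hα.2).le] at h3
  exact absurd (h1.trans h3) (not_le.2 ((ENNReal.ofReal_lt_ofReal_iff hα.1).2 ha))

/-- An upper bound of a function on `(0, b]` with `α < b` is one for the right `α`-quantile of its
law. -/
lemma quantilePlus_map_le {h : ℝ → ℝ} (hm : AEMeasurable h unif) (hα : 0 < α) {b v : ℝ}
    (hb : α < b) (hb1 : b ≤ 1) (hv : ∀ u ∈ Ioo (0 : ℝ) 1, u ≤ b → h u ≤ v) :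
    quantilePlus (unif.map h) α ≤ v := by
  have := Measure.isProbabilityMeasure_map hm
  refine csInf_le (bddBelow_lt_cdf hα) (hb.trans_le ?_)
  rw [cdf_eq_real, measureReal_def, Measure.map_apply_of_aemeasurable hm measurableSet_Iic,
    ← ENNReal.ofReal_le_iff_le_toReal (measure_ne_top _ _), ← unif_Iic hb1]
  refine measure_mono_ae ?_
  filter_upwards [ae_unif_mem] with w hw hwb
  exact hv w hw hwb

end Quantile

/-! ### Optimality of the comonotone coupling. -/

section Wasserstein

/-- The pairs of points with a given interval strictly between them. -/
def crossing : Set ((ℝ × ℝ) × (ℝ × ℝ)) := {w | w.1.1 ≤ w.2.1 ∧ w.2.1 < w.2.2 ∧ w.2.2 < w.1.2}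

lemma measurableSet_crossing : MeasurableSet crossing := by
  unfold crossing
  measurability

/-- For x < y the section is a right triangle with both legs y - x. -/
lemma two_mul_volume_crossing (p : ℝ × ℝ) :
    2 * volume (Prod.mk p ⁻¹' crossing) = ENNReal.ofReal (max (p.2 - p.1) 0 ^ 2) := by
  obtain ⟨x, y⟩ := p
  rcases le_total y x with h | h
  · have : Prod.mk (x, y) ⁻¹' crossing = ∅ := by
      ext z
      simp only [crossing, mem_preimage, mem_ofPred_eq, mem_empty_iff_false, iff_false]
      rintro ⟨h1, h2, h3⟩
      linarith
    rw [this, max_eq_right (by linarith)]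
    simp
  · have : Prod.mk (x, y) ⁻¹' crossing = regionBetween (fun s => s) (fun _ => y) (Icc x y) := by
      ext z
      simp only [crossing, mem_preimage, mem_ofPred_eq, regionBetween, mem_Icc, mem_Ioo]
      constructor
      · rintro ⟨h1, h2, h3⟩
        exact ⟨⟨h1, by linarith⟩, h2, h3⟩
      · rintro ⟨⟨h1, _⟩, h2, h3⟩
        exact ⟨h1, h2, h3⟩
    rw [this, Measure.volume_eq_prod, volume_regionBetween_eq_integral (f := fun s => s)
      (continuous_id.integrableOn_Icc) (continuous_const.integrableOn_Icc) measurableSet_Icc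
      (fun s hs => hs.2), integral_Icc_eq_integral_Ioc,
      ← intervalIntegral.integral_of_le h, max_eq_left (by linarith)]
    have : ∫ s in x..y, ((fun _ => y) - fun s => s : ℝ → ℝ) s = (y - x) ^ 2 / 2 := by
      simp only [Pi.sub_apply]
      rw [intervalIntegral.integral_sub (by simp) (by simp)]
      simp
      ring
    rw [this, ← ENNReal.ofReal_ofNat 2, ← ENNReal.ofReal_mul (by norm_num)]
    congr 1
    ring

/-- Tonelli writes the quadratic cost as an integral over s < t of the probabilities π(X ≤ s, Y > t)
and their mirror images, so couplings can be compared event by event. -/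
lemma lintegral_sq_eq (π : Measure (ℝ × ℝ)) [SFinite π] :
    ∫⁻ p, ENNReal.ofReal ((p.1 - p.2) ^ 2) ∂π =
      2 * (∫⁻ z, π {p | (p, z) ∈ crossing}) + 2 * ∫⁻ z, π {p | (p.swap, z) ∈ crossing} := by
  have hs : Measurable (fun p : ℝ × ℝ => p.swap) := measurable_swap
  have hm := measurable_measure_prodMk_left (ν := (volume : Measure (ℝ × ℝ))) measurableSet_crossing
  have e1 : ∀ (π : Measure (ℝ × ℝ)) [SFinite π], ∫⁻ z, π {p | (p, z) ∈ crossing} =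
      ∫⁻ p, volume (Prod.mk p ⁻¹' crossing) ∂π := fun π _ => by
    rw [← Measure.prod_apply measurableSet_crossing,
      Measure.prod_apply_symm measurableSet_crossing]
    rfl
  have e2 : ∫⁻ z, π {p | (p.swap, z) ∈ crossing} =
      ∫⁻ p, volume (Prod.mk p.swap ⁻¹' crossing) ∂π := by
    rw [← lintegral_map hm hs, ← e1]
    refine lintegral_congr fun z => ?_
    rw [Measure.map_apply hs]
    · rfl
    · exact measurable_prodMk_right measurableSet_crossing
  have hm' : Measurable fun p : ℝ × ℝ => volume (Prod.mk p.swap ⁻¹' crossing) := hm.comp hs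
  rw [e1, e2, ← lintegral_const_mul _ hm, ← lintegral_const_mul _ hm',
    ← lintegral_add_left (hm.const_mul 2)]
  refine lintegral_congr fun p => ?_
  rw [two_mul_volume_crossing, two_mul_volume_crossing,
    ← ENNReal.ofReal_add (by positivity) (by positivity)]
  congr 1
  rcases le_total p.1 p.2 with h | h
  · rw [max_eq_left (by linarith), max_eq_right (by simp; linarith)]
    ring
  · rw [max_eq_right (by linarith), max_eq_left (by simp; linarith)]
    simp

variable {F G : Measure ℝ}

lemma swap_mem_couplings {π : Measure (ℝ × ℝ)} (hπ : π ∈ couplings F G) :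
    π.map Prod.swap ∈ couplings G F := by
  refine ⟨?_, ?_⟩
  · rw [Measure.fst_map_swap, hπ.2]
  · rw [Measure.snd_map_swap, hπ.1]

variable [IsProbabilityMeasure F]

lemma isProbabilityMeasure_of_mem_couplings {π : Measure (ℝ × ℝ)} (hπ : π ∈ couplings F G) :
    IsProbabilityMeasure π := by
  refine ⟨?_⟩
  rw [← Measure.fst_univ, hπ.1, measure_univ]

variable [IsProbabilityMeasure G]

/-- The comonotone coupling gives the least mass to the event that an interval is crossed. -/
lemma unif_crossing_le {π : Measure (ℝ × ℝ)} (hπ : π ∈ couplings F G) (z : ℝ × ℝ) :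
    unif {u | ((quantile F u, quantile G u), z) ∈ crossing} ≤ π {p | (p, z) ∈ crossing} := by
  have := isProbabilityMeasure_of_mem_couplings hπ
  by_cases hz : z.1 < z.2
  -- With z = (s, t), the comonotone pair crosses only when G(t) < u ≤ F(s), with probability (F(s)
  -- - G(t))₊. Any coupling has at least this, because {X ≤ s} is covered by the crossing event and
  -- {Y ≤ t}.
  · have h1 : unif {u | ((quantile F u, quantile G u), z) ∈ crossing} ≤
        unif (Ioc (cdf G z.2) (cdf F z.1)) := by
      refine measure_mono_ae ?_
      filter_upwards [ae_unif_mem] with u hu h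
      refine ⟨?_, (quantile_le_iff hu).1 h.1⟩
      by_contra h'
      exact absurd ((quantile_le_iff hu).2 (not_lt.1 h')) (not_le.2 h.2.2)
    rw [unif_Ioc (cdf_nonneg G _) (cdf_le_one F _), ENNReal.ofReal_sub _ (cdf_nonneg G _),
      ofReal_cdf, ofReal_cdf] at h1
    refine h1.trans (tsub_le_iff_right.2 ?_)
    rw [← hπ.1, ← hπ.2, Measure.fst_apply measurableSet_Iic, Measure.snd_apply measurableSet_Iic]
    refine le_trans (measure_mono ?_) (measure_union_le _ _)
    intro p hp
    by_cases h : p.2 ≤ z.2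
    · exact Or.inr h
    · exact Or.inl ⟨hp, hz, not_le.1 h⟩
  · have : {u | ((quantile F u, quantile G u), z) ∈ crossing} = ∅ := by
      ext u
      simp [crossing, hz]
    simp [this]

lemma map_prodMk_mem_couplings {X Y : ℝ → ℝ} (hX : AEMeasurable X unif) (hY : AEMeasurable Y unif) :
    unif.map (fun u => (X u, Y u)) ∈ couplings (unif.map X) (unif.map Y) :=
  ⟨Measure.fst_map_prodMk₀ hY, Measure.snd_map_prodMk₀ hX⟩

/-- Optimality of the comonotone coupling for the quadratic cost. -/
lemma lintegral_quantile_le {π : Measure (ℝ × ℝ)} (hπ : π ∈ couplings F G) :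
    ∫⁻ u, ENNReal.ofReal ((quantile F u - quantile G u) ^ 2) ∂unif ≤
      ∫⁻ p, ENNReal.ofReal ((p.1 - p.2) ^ 2) ∂π := by
  have := isProbabilityMeasure_of_mem_couplings hπ
  have hF := aemeasurable_quantile (G := F)
  have hG := aemeasurable_quantile (G := G)
  have hFG := hF.prodMk hG
  have hsm : ∀ z, MeasurableSet {p : ℝ × ℝ | (p, z) ∈ crossing} := fun z =>
    measurable_prodMk_right measurableSet_crossing
  have e : ∫⁻ u, ENNReal.ofReal ((quantile F u - quantile G u) ^ 2) ∂unif =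
      ∫⁻ p, ENNReal.ofReal ((p.1 - p.2) ^ 2) ∂(unif.map fun u => (quantile F u, quantile G u)) := by
    rw [lintegral_map' (by fun_prop) hFG]
  have : IsProbabilityMeasure (unif.map fun u => (quantile F u, quantile G u)) :=
    Measure.isProbabilityMeasure_map hFG
  rw [e, lintegral_sq_eq, lintegral_sq_eq]
  refine add_le_add (mul_le_mul_right (lintegral_mono fun z => ?_) 2)
    (mul_le_mul_right (lintegral_mono fun z => ?_) 2)
  · rw [Measure.map_apply_of_aemeasurable hFG (hsm z)]
    exact unif_crossing_le hπ z
  · have hsw : MeasurableSet {p : ℝ × ℝ | (p.swap, z) ∈ crossing} := measurable_swap (hsm z)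
    rw [Measure.map_apply_of_aemeasurable hFG hsw]
    have := unif_crossing_le (swap_mem_couplings hπ) z
    rw [Measure.map_apply measurable_swap (hsm z)] at this
    exact this

/-- No monotonicity is needed, since X(U) and Y(U) are coupled in any case; competitors can thus be
placed in the ball without computing their quantile functions. -/
lemma dW_map_le {X Y : ℝ → ℝ} (hX : AEMeasurable X unif) (hY : AEMeasurable Y unif) :
    dW (unif.map X) (unif.map Y) ≤ √(∫ u, (X u - Y u) ^ 2 ∂unif) := by
  refine csInf_le ⟨0, ?_⟩ ⟨_, map_prodMk_mem_couplings hX hY, ?_⟩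
  · rintro _ ⟨π, _, rfl⟩
    exact Real.sqrt_nonneg _
  · simp only
    rw [integral_map (hX.prodMk hY)]
    exact Measurable.aestronglyMeasurable (by fun_prop)

/-- The Wasserstein distance is the `L²` distance of the quantile functions. -/
theorem dW_eq (hF : MemLp id 2 F) (hG : MemLp id 2 G) :
    dW F G = √(∫ u, (quantile F u - quantile G u) ^ 2 ∂unif) := by
  have hqF := aemeasurable_quantile (G := F)
  have hqG := aemeasurable_quantile (G := G)
  refine le_antisymm ?_ ?_
  · have := dW_map_le hqF hqG
    rwa [map_quantile, map_quantile] at this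
  · have hne : (couplings F G).Nonempty := by
      have := map_prodMk_mem_couplings hqF hqG
      rw [map_quantile, map_quantile] at this
      exact ⟨_, this⟩
    refine le_csInf (hne.image _) ?_
    rintro _ ⟨π, hπ, rfl⟩
    refine Real.sqrt_le_sqrt ?_
    have := isProbabilityMeasure_of_mem_couplings hπ
    have hfst : MemLp (fun p : ℝ × ℝ => p.1) 2 π := by
      have := hF
      rw [← hπ.1] at this
      exact (memLp_map_measure_iff aestronglyMeasurable_id measurable_fst.aemeasurable).1 this
    have hsnd : MemLp (fun p : ℝ × ℝ => p.2) 2 π := by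
      have := hG
      rw [← hπ.2] at this
      exact (memLp_map_measure_iff aestronglyMeasurable_id measurable_snd.aemeasurable).1 this
    -- Needed because a non-integrable cost would have Bochner integral 0 and spoil the comparison.
    have hint : Integrable (fun p : ℝ × ℝ => (p.1 - p.2) ^ 2) π := (hfst.sub hsnd).integrable_sq
    rw [integral_eq_lintegral_of_nonneg_ae (ae_of_all _ fun u => sq_nonneg _)
        (AEMeasurable.aestronglyMeasurable (by fun_prop)),
      integral_eq_lintegral_of_nonneg_ae (ae_of_all _ fun u => sq_nonneg _)
        hint.aestronglyMeasurable]
    refine ENNReal.toReal_mono ?_ (lintegral_quantile_le hπ)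
    exact hint.lintegral_lt_top.ne

lemma integral_sub_sq {Ω : Type*} [MeasurableSpace Ω] {P : Measure Ω} [IsProbabilityMeasure P]
    {X Y : Ω → ℝ} (hX : MemLp X 2 P) (hY : MemLp Y 2 P) :
    ∫ ω, (X ω - Y ω) ^ 2 ∂P = (∫ ω, X ω ∂P - ∫ ω, Y ω ∂P) ^ 2 + Var[X; P] + Var[Y; P] -
      2 * cov[X, Y; P] := by
  have h1 := variance_sub hX hY
  rw [variance_eq_sub (hX.sub hY),
    integral_sub' (hX.integrable one_le_two) (hY.integrable one_le_two)] at h1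
  simp only [Pi.pow_apply, Pi.sub_apply] at h1
  linarith

lemma quantile_moments (hG : MemLp id 2 G) {m s : ℝ} (hm : ∫ x, x ∂G = m)
    (hs : ∫ x, x ^ 2 ∂G = m ^ 2 + s ^ 2) :
    MemLp (quantile G) 2 unif ∧ ∫ u, quantile G u ∂unif = m ∧ Var[quantile G; unif] = s ^ 2 := by
  have hq := aemeasurable_quantile (G := G)
  have h1 : MemLp (quantile G) 2 unif := by
    have := hG
    rw [← map_quantile (G := G)] at this
    exact (memLp_map_measure_iff aestronglyMeasurable_id hq).1 this
  have h2 : ∫ u, quantile G u ∂unif = m := by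
    rw [← hm]
    nth_rewrite 2 [← map_quantile (G := G)]
    rw [integral_map hq (by fun_prop)]
  refine ⟨h1, h2, ?_⟩
  rw [variance_eq_sub h1, h2]
  have h3 : ∫ x, x ^ 2 ∂G = ∫ u, (quantile G ^ 2) u ∂unif := by
    nth_rewrite 1 [← map_quantile (G := G)]
    rw [integral_map hq (by fun_prop)]
    rfl
  linarith

lemma map_moments {h : ℝ → ℝ} (hh : MemLp h 2 unif) :
    MemLp id 2 (unif.map h) ∧ ∫ x, x ∂(unif.map h) = ∫ u, h u ∂unif ∧
      ∫ x, x ^ 2 ∂(unif.map h) = (∫ u, h u ∂unif) ^ 2 + Var[h; unif] := by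
  have hm := hh.aemeasurable
  refine ⟨(memLp_map_measure_iff aestronglyMeasurable_id hm).2 hh,
    integral_map hm (by fun_prop), ?_⟩
  rw [variance_eq_sub hh, integral_map hm (by fun_prop)]
  simp

end Wasserstein

/-! ### The Wasserstein ball as a covariance constraint. -/

section UncertaintySet

variable {F G : Measure ℝ} [IsProbabilityMeasure F] {μF σF μ σ ε R : ℝ}

lemma dW_eq_of_moments [IsProbabilityMeasure G] (hF : MemLp id 2 F) (hμF : ∫ x, x ∂F = μF)
    (hσF : ∫ x, x ^ 2 ∂F = μF ^ 2 + σF ^ 2) (hG : MemLp id 2 G) (hμ : ∫ x, x ∂G = μ)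
    (hσ : ∫ x, x ^ 2 ∂G = μ ^ 2 + σ ^ 2) :
    dW F G = √((μF - μ) ^ 2 + σF ^ 2 + σ ^ 2 - 2 * cov[quantile F, quantile G; unif]) ∧
      0 ≤ (μF - μ) ^ 2 + σF ^ 2 + σ ^ 2 - 2 * cov[quantile F, quantile G; unif] := by
  obtain ⟨f1, f2, f3⟩ := quantile_moments hF hμF hσF
  obtain ⟨g1, g2, g3⟩ := quantile_moments hG hμ hσ
  have h := integral_sub_sq f1 g1
  rw [f2, f3, g2, g3] at h
  rw [dW_eq hF hG, ← h]
  exact ⟨rfl, integral_nonneg fun u => sq_nonneg _⟩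

lemma le_covariance_of_mem (hF : MemLp id 2 F) (hμF : ∫ x, x ∂F = μF)
    (hσF : ∫ x, x ^ 2 ∂F = μF ^ 2 + σF ^ 2) (hε : 0 ≤ ε)
    (hR : 2 * (R * σ) = (μF - μ) ^ 2 + σF ^ 2 + σ ^ 2 - ε) (hG : G ∈ uncertaintySet F μ σ ε) :
    R * σ ≤ cov[quantile F, quantile G; unif] := by
  obtain ⟨g1, g2, g3, g4, g5⟩ := hG
  rw [(dW_eq_of_moments hF hμF hσF g2 g3 g4).1, Real.sqrt_le_sqrt_iff hε] at g5
  linarith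

lemma dW_eq_sqrt_iff [IsProbabilityMeasure G] (hF : MemLp id 2 F) (hμF : ∫ x, x ∂F = μF)
    (hσF : ∫ x, x ^ 2 ∂F = μF ^ 2 + σF ^ 2) (hε : 0 ≤ ε)
    (hR : 2 * (R * σ) = (μF - μ) ^ 2 + σF ^ 2 + σ ^ 2 - ε) (hG : MemLp id 2 G)
    (hμ : ∫ x, x ∂G = μ) (hσ : ∫ x, x ^ 2 ∂G = μ ^ 2 + σ ^ 2) :
    dW F G = √ε ↔ cov[quantile F, quantile G; unif] = R * σ := by
  obtain ⟨h1, h2⟩ := dW_eq_of_moments hF hμF hσF hG hμ hσ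
  rw [h1, Real.sqrt_inj h2 hε]
  constructor <;> intro h <;> linarith

lemma map_mem_uncertaintySet (hF : MemLp id 2 F) (hμF : ∫ x, x ∂F = μF)
    (hσF : ∫ x, x ^ 2 ∂F = μF ^ 2 + σF ^ 2)
    (hR : 2 * (R * σ) = (μF - μ) ^ 2 + σF ^ 2 + σ ^ 2 - ε) {h : ℝ → ℝ} (hh : MemLp h 2 unif)
    (hm : ∫ u, h u ∂unif = μ) (hv : Var[h; unif] = σ ^ 2)
    (hc : R * σ ≤ cov[quantile F, h; unif]) : unif.map h ∈ uncertaintySet F μ σ ε := by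
  obtain ⟨h1, h2, h3⟩ := map_moments hh
  obtain ⟨f1, f2, f3⟩ := quantile_moments hF hμF hσF
  rw [hm] at h2 h3
  rw [hv] at h3
  refine ⟨Measure.isProbabilityMeasure_map hh.aemeasurable, h1, h2, h3, ?_⟩
  have h4 := dW_map_le f1.aemeasurable hh.aemeasurable
  rw [map_quantile, integral_sub_sq f1 hh, f2, f3, hm, hv] at h4
  exact h4.trans (Real.sqrt_le_sqrt (by linarith))

end UncertaintySet

/-! ### Tail indicators, and the mean excess over an interval. -/

section Indicators

variable {α : ℝ}

lemma frequently_unif_le (hα : α ∈ Ioo (0 : ℝ) 1) : ∃ᵐ u ∂unif, u ≤ α := by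
  rw [frequently_ae_iff]
  change unif (Iic α) ≠ 0
  rw [unif_Iic hα.2.le]
  simpa using hα.1

lemma frequently_lt_unif (hα : α ∈ Ioo (0 : ℝ) 1) : ∃ᵐ u ∂unif, α < u := by
  intro h
  have h1 : unif (Ioc α 1) = 0 := measure_mono_null (fun u hu => by simpa using hu.1) h
  rw [unif_Ioc hα.1.le le_rfl] at h1
  simp only [ENNReal.ofReal_eq_zero] at h1
  linarith [hα.2]

lemma indicator_Ioo_ae_eq : ((Ioo α 1).indicator fun _ => (1 : ℝ)) =ᵐ[unif]
    (Ioi α).indicator fun _ => (1 : ℝ) := by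
  filter_upwards [ae_unif_mem] with u hu
  by_cases h : α < u
  · rw [indicator_of_mem (s := Ioo α 1) ⟨h, hu.2⟩, indicator_of_mem (s := Ioi α) h]
  · rw [indicator_of_notMem (s := Ioo α 1) fun h' => h h'.1, indicator_of_notMem (s := Ioi α) h]

/-- Carries the correlation hypothesis to the best case: passing to the complement and replacing `q`
by `-q` changes the sign of the covariance twice. -/
lemma indicator_Iic_eq : ((Iic α).indicator fun _ => (1 : ℝ)) =
    fun u => 1 - (Ioi α).indicator (fun _ => (1 : ℝ)) u := by
  ext u
  by_cases h : u ≤ α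
  · rw [indicator_of_mem (s := Iic α) h, indicator_of_notMem (s := Ioi α) (not_lt.2 h), sub_zero]
  · rw [indicator_of_notMem (s := Iic α) h, indicator_of_mem (s := Ioi α) (not_le.1 h), sub_self]

lemma memLp_indicator_Ioi : MemLp ((Ioi α).indicator fun _ => (1 : ℝ)) 2 unif :=
  (memLp_const 1).indicator measurableSet_Ioi

lemma variance_indicator_pos (hα : α ∈ Ioo (0 : ℝ) 1) :
    0 < Var[(Ioi α).indicator fun _ => (1 : ℝ); unif] := by
  refine (variance_nonneg _ _).lt_of_ne fun h => ?_
  have hae := ae_eq_integral_of_variance_eq_zero memLp_indicator_Ioi h.symm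
  obtain ⟨u, h1, h2⟩ := ((frequently_unif_le hα).and_eventually hae).exists
  obtain ⟨v, h3, h4⟩ := ((frequently_lt_unif hα).and_eventually hae).exists
  rw [indicator_of_notMem (s := Ioi α) (not_lt.2 h1)] at h2
  rw [indicator_of_mem (s := Ioi α) h3, ← h2] at h4
  exact one_ne_zero h4

lemma integral_indicator_Ioc {a b : ℝ} (ha : 0 ≤ a) (hab : a ≤ b) (hb : b ≤ 1) (f : ℝ → ℝ) :
    ∫ u, (Ioc a b).indicator f u ∂unif = ∫ u in a..b, f u := by
  rw [integral_indicator measurableSet_Ioc, unif, Measure.restrict_congr_set Ioo_ae_eq_Ioc,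
    Measure.restrict_restrict measurableSet_Ioc, inter_eq_left.2 (Ioc_subset_Ioc ha hb),
    intervalIntegral.integral_of_le hab]

lemma intervalIntegrable_of_memLp {f : ℝ → ℝ} (hf : MemLp f 2 unif) {a b : ℝ} (ha : 0 ≤ a)
    (hab : a ≤ b) (hb : b ≤ 1) : IntervalIntegrable f volume a b := by
  have h : IntegrableOn f (Ioc 0 1) volume := by
    rw [IntegrableOn, ← Measure.restrict_congr_set Ioo_ae_eq_Ioc]
    exact hf.integrable one_le_two
  exact (intervalIntegrable_iff_integrableOn_Ioc_of_le hab).2 (h.mono_set (Ioc_subset_Ioc ha hb))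

/-- The mean excess over an interval on which the level is not reached. -/
lemma integral_excess_eq {p : ℝ → ℝ} {A : Set ℝ} {lam c a b : ℝ} (hp : MemLp p 2 unif)
    (ha : 0 ≤ a) (hab : a ≤ b) (hb : b ≤ 1) (hA : ∀ u ∈ Ioo (0 : ℝ) 1, u ∈ Ioc a b → u ∈ A)
    (h1 : ∀ u ∈ Ioo (0 : ℝ) 1, u ∈ Ioc a b → lam * p u ≤ c)
    (h2 : ∀ u ∈ Ioo (0 : ℝ) 1, u ∈ A → u ∉ Ioc a b → c ≤ lam * p u) :
    ∫ u, excess p A lam c u ∂unif = c * (b - a) - lam * ∫ u in a..b, p u := by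
  have h : excess p A lam c =ᵐ[unif] (Ioc a b).indicator fun u => c - lam * p u := by
    filter_upwards [ae_unif_mem] with u hu
    by_cases hI : u ∈ Ioc a b
    · rw [indicator_of_mem hI, excess, indicator_of_mem (hA u hu hI),
        max_eq_left (by linarith [h1 u hu hI])]
    · rw [indicator_of_notMem hI, excess]
      by_cases huA : u ∈ A
      · rw [indicator_of_mem huA, max_eq_right (by linarith [h2 u hu huA hI])]
      · rw [indicator_of_notMem huA]
  have hi := intervalIntegrable_of_memLp hp ha hab hb
  rw [integral_congr_ae h, integral_indicator_Ioc ha hab hb,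
    intervalIntegral.integral_sub (by simp) (hi.const_mul lam),
    intervalIntegral.integral_const_mul, intervalIntegral.integral_const, smul_eq_mul, mul_comm]

end Indicators

/-! ### Lifting the quantile function above α, and the worst-case RVaR parameters. -/

section WorstCase

variable {F : Measure ℝ} {μ σ α β lam w₁ c : ℝ}

/-- With `w₀ = α` the branch containing `1 / (β - α)` is empty, so the function does not depend on
`β`. -/
lemma rvarWorst_eq_lifted {q : ℝ → ℝ} (h : IsRVaRWorstParams q α β lam α w₁ c) {u : ℝ}
    (hu : u ∈ Ioo (0 : ℝ) 1) : rvarWorst q α β lam α w₁ c u = lifted q (Ioi α) lam c u := by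
  unfold rvarWorst
  by_cases h1 : u ≤ α
  · rw [if_pos h1, lifted_of_notMem (A := Ioi α) (not_lt.2 h1)]
  · rw [if_neg h1, if_neg h1, lifted_of_mem (A := Ioi α) (not_le.1 h1)]
    by_cases h2 : u ≤ w₁
    · rw [if_pos h2, max_eq_left (h.before_w₁ u hu (not_le.1 h1) h2)]
    · rw [if_neg h2, max_eq_right (h.after_w₁ u hu (not_le.1 h2))]

lemma hUp_rvarWorst {q : ℝ → ℝ} (h : IsRVaRWorstParams q α β lam α w₁ c) {u : ℝ}
    (hu : u ∈ Ioo (0 : ℝ) 1) : hUp μ σ (rvarWorst q α β lam α w₁ c) u =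
      μ + σ * ((lifted q (Ioi α) lam c u - ∫ u, lifted q (Ioi α) lam c u ∂unif) /
        √Var[lifted q (Ioi α) lam c; unif]) := by
  have hae : rvarWorst q α β lam α w₁ c =ᵐ[unif] lifted q (Ioi α) lam c :=
    ae_unif_mem.mono fun u hu => rvarWorst_eq_lifted h hu
  rw [hUp, meanU, stdU, integral_congr_ae hae, variance_congr hae, rvarWorst_eq_lifted h hu]

/-- With `w₀ = α` the term `(β - w₀) / (β - α)` is 1 for every `β`, so `c_eq` is precisely the
normalisation in `IsOptimalLift`. -/
lemma integral_excess_worst {q : ℝ → ℝ} (hq : MemLp q 2 unif) (hα : 0 ≤ α) (hβ : α < β)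
    (h : IsRVaRWorstParams q α β lam α w₁ c) : ∫ u, excess q (Ioi α) lam c u ∂unif = 1 := by
  rw [integral_excess_eq (A := Ioi α) hq hα (hβ.le.trans h.beta_le) h.le_one (fun u _ hu => hu.1)
    (fun u hu hI => h.before_w₁ u hu hI.1 hI.2)
    (fun u hu hA hI => h.after_w₁ u hu (not_le.1 fun h' => hI ⟨hA, h'⟩)), h.c_eq,
    div_self (sub_ne_zero.2 hβ.ne')]
  ring

lemma monotoneOn_lifted_quantile (hlam : 0 ≤ lam) :
    MonotoneOn (lifted (quantile F) (Ioi α) lam c) (Ioo 0 1) := by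
  intro u hu v hv huv
  have hq := mul_le_mul_of_nonneg_left (monotoneOn_quantile (G := F) hu hv huv) hlam
  by_cases hvα : α < v
  · rw [lifted_of_mem (A := Ioi α) hvα]
    by_cases huα : α < u
    · rw [lifted_of_mem (A := Ioi α) huα]
      exact max_le_max_left _ hq
    · rw [lifted_of_notMem (A := Ioi α) huα]
      exact hq.trans (le_max_right _ _)
  · rw [lifted_of_notMem (A := Ioi α) hvα, lifted_of_notMem (A := Ioi α) fun h => hvα (h.trans_le huv)]
    exact hq

lemma exists_lt_lifted_quantile (hlam : 0 < lam) (hα : 0 ≤ α) {u y : ℝ} (hu : u ∈ Ioo (0 : ℝ) 1)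
    (hy : y < lifted (quantile F) (Ioi α) lam c u) :
    ∃ v ∈ Ioo 0 u, y < lifted (quantile F) (Ioi α) lam c v := by
  have key : y < lam * quantile F u → ∃ v ∈ Ioo 0 u, y < lam * quantile F v := fun h => by
    rw [← div_lt_iff₀' hlam] at h
    obtain ⟨v, hv, h⟩ := exists_lt_quantile hu h
    exact ⟨v, hv, (div_lt_iff₀' hlam).1 h⟩
  have hge : ∀ v, lam * quantile F v ≤ lifted (quantile F) (Ioi α) lam c v := fun v => by
    rw [lifted]
    linarith [excess_nonneg (p := quantile F) (A := Ioi α) (lam := lam) (c := c) v]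
  by_cases huα : α < u
  · rw [lifted_of_mem (A := Ioi α) huα, lt_max_iff] at hy
    rcases hy with hy | hy
    · obtain ⟨v, hv⟩ := exists_between huα
      refine ⟨v, ⟨hα.trans_lt hv.1, hv.2⟩, ?_⟩
      rw [lifted_of_mem (A := Ioi α) (mem_Ioi.2 hv.1)]
      exact hy.trans_le (le_max_left _ _)
    · obtain ⟨v, hv, h⟩ := key hy
      exact ⟨v, hv, h.trans_le (hge v)⟩
  · rw [lifted_of_notMem (A := Ioi α) huα] at hy
    obtain ⟨v, hv, h⟩ := key hy
    exact ⟨v, hv, h.trans_le (hge v)⟩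

/-- The parameters of the worst-case quantile, with the right end of the flat part given by the
distribution function. -/
lemma isRVaRWorstParams_cdf [IsProbabilityMeasure F] (hq : MemLp (quantile F) 2 unif)
    (hα : α ∈ Ioo (0 : ℝ) 1) (hlam : 0 < lam)
    (h1 : ∫ u, excess (quantile F) (Ioi α) lam c u ∂unif = 1) :
    α < cdf F (c / lam) ∧ lam * quantile F α < c ∧ ∃ β₀ > α, ∀ β ∈ Ioc α β₀,
      IsRVaRWorstParams (quantile F) α β lam α (cdf F (c / lam)) c := by
  have hpos : 0 < ∫ u, excess (quantile F) (Ioi α) lam c u ∂unif := by rw [h1]; exact one_pos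
  have hle : ∀ u ∈ Ioo (0 : ℝ) 1, (lam * quantile F u ≤ c ↔ u ≤ cdf F (c / lam)) := fun u hu => by
    rw [← quantile_le_iff hu, le_div_iff₀' hlam]
  obtain ⟨u, ⟨hαu, huc⟩, hu⟩ :=
    ((exists_lt_of_integral_excess_pos hpos).and_eventually ae_unif_mem).exists
  have hw : α < cdf F (c / lam) := lt_of_lt_of_le hαu ((hle u hu).1 huc.le)
  have hαc : lam * quantile F α < c :=
    (mul_le_mul_of_nonneg_left (monotoneOn_quantile hα hu (le_of_lt hαu)) hlam.le).trans_lt huc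
  have hbefore : ∀ u ∈ Ioo (0 : ℝ) 1, α < u → u ≤ cdf F (c / lam) → lam * quantile F u ≤ c :=
    fun u hu _ h => (hle u hu).2 h
  have hafter : ∀ u ∈ Ioo (0 : ℝ) 1, cdf F (c / lam) < u → c ≤ lam * quantile F u :=
    fun u hu h => (not_le.1 fun h' => absurd ((hle u hu).1 h') (not_le.2 h)).le
  -- The first bound keeps `β` within the flat part; the second makes the jump `1 / (β - α)` at
  -- least `c - lam * quantile F α`, so that `c` is overshot immediately after `α`.
  refine ⟨hw, hαc, min (cdf F (c / lam)) (α + 1 / (c - lam * quantile F α)), ?_, ?_⟩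
  · refine lt_min hw (lt_add_of_pos_right _ (one_div_pos.2 (by linarith)))
  · intro β hβ
    have hβ1 := hβ.2.trans (min_le_left _ _)
    have hβ2 := hβ.2.trans (min_le_right _ _)
    refine ⟨le_rfl, hβ.1.le, hβ1, cdf_le_one F _, fun u _ h h' => absurd h (not_lt.2 h'), ?_,
      hbefore, hafter, ?_⟩
    · intro u hu hαu _
      have h2 := mul_le_mul_of_nonneg_left (monotoneOn_quantile (G := F) hα hu hαu.le) hlam.le
      have h3 : c - lam * quantile F α ≤ 1 / (β - α) := by
        rw [le_one_div (by linarith) (sub_pos.2 hβ.1)]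
        linarith
      linarith
    · rw [integral_excess_eq (A := Ioi α) hq hα.1.le hw.le (cdf_le_one F _) (fun u _ hu => hu.1)
        (fun u hu hI => hbefore u hu hI.1 hI.2)
        (fun u hu hA hI => hafter u hu (not_le.1 fun h' => hI ⟨hA, h'⟩))] at h1
      rw [div_self (sub_ne_zero.2 hβ.1.ne')]
      linarith

/-- The sets shrink to `Ici α`, so the null point `α` has to be discarded. -/
lemma ae_eventually_mem_Ioi_iff :
    ∀ᵐ u ∂unif, ∀ᶠ n : ℕ in atTop, (u ∈ Ioi (α - 1 / ((n : ℝ) + 1)) ↔ u ∈ Ioi α) := by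
  have hne : ∀ᵐ u ∂unif, u ≠ α := ae_restrict_of_ae (Measure.ae_ne volume α)
  filter_upwards [hne] with u hu
  rcases lt_or_gt_of_ne hu with h | h
  · have ht : Tendsto (fun n : ℕ => α - 1 / ((n : ℝ) + 1)) atTop (𝓝 (α - 0)) :=
      tendsto_const_nhds.sub tendsto_one_div_add_atTop_nhds_zero_nat
    rw [sub_zero] at ht
    filter_upwards [ht.eventually_const_lt h] with n hn
    simp only [mem_Ioi]
    constructor <;> intro <;> linarith
  · refine Eventually.of_forall fun n => ?_
    have : (0 : ℝ) < 1 / ((n : ℝ) + 1) := by positivity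
    simp only [mem_Ioi]
    constructor <;> intro <;> linarith

end WorstCase

/-! ### The mirror image: lifting the negated quantile function up to α. -/

section BestCase

variable {F : Measure ℝ} {μ σ a α lam z₀ c : ℝ}

lemma rvarBest_eq_lifted {q : ℝ → ℝ} (h : IsRVaRBestParams q a α lam z₀ α c) {u : ℝ}
    (hu : u ∈ Ioo (0 : ℝ) 1) :
    rvarBest q a α lam z₀ α c u = lifted (fun u => -q u) (Iic α) lam (-c) u := by
  unfold rvarBest
  by_cases h1 : u ≤ α
  · rw [lifted_of_mem (A := Iic α) (mem_Iic.2 h1)]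
    by_cases h2 : u ≤ z₀
    · rw [if_pos h2, max_eq_right (by linarith [h.before_z₀ u hu h2])]
      ring
    · rw [if_neg h2, if_pos h1, max_eq_left (by linarith [h.after_z₀ u hu (not_le.1 h2) h1])]
  · have h2 : ¬ u ≤ z₀ := fun h' => h1 (h'.trans (h.le_alpha.trans h.alpha_le))
    rw [if_neg h2, if_neg h1, if_neg h1, lifted_of_notMem (A := Iic α) h1]
    ring

lemma hDown_rvarBest {q : ℝ → ℝ} (h : IsRVaRBestParams q a α lam z₀ α c) {u : ℝ}
    (hu : u ∈ Ioo (0 : ℝ) 1) : hDown μ σ (rvarBest q a α lam z₀ α c) u =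
      -(-μ + σ * ((lifted (fun u => -q u) (Iic α) lam (-c) u -
        ∫ u, lifted (fun u => -q u) (Iic α) lam (-c) u ∂unif) /
        √Var[lifted (fun u => -q u) (Iic α) lam (-c); unif])) := by
  have hae : rvarBest q a α lam z₀ α c =ᵐ[unif] lifted (fun u => -q u) (Iic α) lam (-c) :=
    ae_unif_mem.mono fun u hu => rvarBest_eq_lifted h hu
  rw [hDown, meanU, stdU, integral_congr_ae hae, variance_congr hae, rvarBest_eq_lifted h hu]
  ring

lemma integral_excess_best {q : ℝ → ℝ} (hq : MemLp q 2 unif) (hα : α ≤ 1) (ha : a < α)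
    (h : IsRVaRBestParams q a α lam z₀ α c) :
    ∫ u, excess (fun u => -q u) (Iic α) lam (-c) u ∂unif = 1 := by
  have hnq : MemLp (fun u => -q u) 2 unif := hq.neg
  have hceq := h.c_eq
  rw [div_self (sub_ne_zero.2 ha.ne')] at hceq
  rw [integral_excess_eq (A := Iic α) hnq h.zero_le (h.le_alpha.trans h.alpha_le) hα (fun u _ hu => hu.2)
    (fun u hu hI => ?_) (fun u hu hA hI => ?_), intervalIntegral.integral_neg]
  · linarith
  · linarith [h.after_z₀ u hu hI.1 hI.2]
  · linarith [h.before_z₀ u hu (not_lt.1 fun h' => hI ⟨h', hA⟩)]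

lemma antitoneOn_lifted_neg_quantile (hlam : 0 ≤ lam) :
    AntitoneOn (lifted (fun u => -quantile F u) (Iic α) lam c) (Ioo 0 1) := by
  intro u hu v hv huv
  have hq := mul_le_mul_of_nonneg_left (neg_le_neg (monotoneOn_quantile (G := F) hu hv huv)) hlam
  by_cases huα : u ≤ α
  · rw [lifted_of_mem (A := Iic α) huα]
    by_cases hvα : v ≤ α
    · rw [lifted_of_mem (A := Iic α) hvα]
      exact max_le_max_left _ hq
    · rw [lifted_of_notMem (A := Iic α) hvα]
      exact hq.trans (le_max_right _ _)
  · rw [lifted_of_notMem (A := Iic α) huα, lifted_of_notMem (A := Iic α) fun h => huα (huv.trans h)]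
    exact hq

lemma exists_lifted_neg_quantile_lt (hlam : 0 < lam) {u y : ℝ} (hu : u ∈ Ioo (0 : ℝ) 1)
    (hy : lifted (fun u => -quantile F u) (Iic α) lam c u < y) :
    ∃ v ∈ Ioo 0 u, lifted (fun u => -quantile F u) (Iic α) lam c v < y := by
  have key : lam * -quantile F u < y → ∃ v ∈ Ioo 0 u, lam * -quantile F v < y := fun h => by
    rw [← lt_div_iff₀' hlam] at h
    obtain ⟨v, hv, h⟩ := exists_lt_quantile hu (neg_lt.1 h)
    exact ⟨v, hv, (lt_div_iff₀' hlam).1 (neg_lt.1 h)⟩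
  by_cases huα : u ≤ α
  · rw [lifted_of_mem (A := Iic α) huα, max_lt_iff] at hy
    obtain ⟨v, hv, h⟩ := key hy.2
    refine ⟨v, hv, ?_⟩
    rw [lifted_of_mem (A := Iic α) (mem_Iic.2 (hv.2.le.trans huα))]
    exact max_lt hy.1 h
  · rw [lifted_of_notMem (A := Iic α) huα] at hy
    obtain ⟨v, hv, h⟩ := key hy
    -- The point `v` may lie in the region `Iic α`, where the function is raised; moving right past
    -- `α` avoids this and only lowers `-quantile F`.
    obtain ⟨w, hw1, hw2⟩ := exists_between (max_lt hv.2 (not_le.1 huα))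
    have hvw := (le_max_left _ _).trans_lt hw1
    have hw : w ∈ Ioo 0 u := ⟨hv.1.trans hvw, hw2⟩
    refine ⟨w, hw, ?_⟩
    rw [lifted_of_notMem (A := Iic α) (not_le.2 ((le_max_right _ _).trans_lt hw1))]
    refine lt_of_le_of_lt (mul_le_mul_of_nonneg_left (neg_le_neg ?_) hlam.le) h
    exact monotoneOn_quantile ⟨hv.1, hv.2.trans hu.2⟩ ⟨hw.1, hw.2.trans hu.2⟩ hvw.le

/-- The parameters of the best-case quantile, with the left end of the flat part given by the
distribution function. -/
lemma isRVaRBestParams_cdf [IsProbabilityMeasure F] (hq : MemLp (quantile F) 2 unif)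
    (hα : α ∈ Ioo (0 : ℝ) 1) (hlam : 0 < lam)
    (h1 : ∫ u, excess (fun u => -quantile F u) (Iic α) lam (-c) u ∂unif = 1) :
    c < lam * quantile F α ∧ ∃ a₀ ∈ Ioo 0 α, ∀ a ∈ Ico a₀ α,
      IsRVaRBestParams (quantile F) a α lam (cdf F (c / lam)) α c := by
  have hpos : 0 < ∫ u, excess (fun u => -quantile F u) (Iic α) lam (-c) u ∂unif := by
    rw [h1]; exact one_pos
  have hle : ∀ u ∈ Ioo (0 : ℝ) 1, (lam * quantile F u ≤ c ↔ u ≤ cdf F (c / lam)) := fun u hu => by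
    rw [← quantile_le_iff hu, le_div_iff₀' hlam]
  obtain ⟨u, ⟨huα, huc⟩, hu⟩ :=
    ((exists_lt_of_integral_excess_pos hpos).and_eventually ae_unif_mem).exists
  have hαc : c < lam * quantile F α := by
    have := mul_le_mul_of_nonneg_left (monotoneOn_quantile (G := F) hu hα huα) hlam.le
    linarith
  have hz : cdf F (c / lam) < α :=
    not_le.1 fun h => absurd ((hle α hα).2 h) (not_le.2 hαc)
  have hbefore : ∀ u ∈ Ioo (0 : ℝ) 1, u ≤ cdf F (c / lam) → lam * quantile F u ≤ c :=
    fun u hu h => (hle u hu).2 h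
  have hafter : ∀ u ∈ Ioo (0 : ℝ) 1, cdf F (c / lam) < u → u ≤ α → c ≤ lam * quantile F u :=
    fun u hu h _ => (not_le.1 fun h' => absurd ((hle u hu).1 h') (not_le.2 h)).le
  have hnq : MemLp (fun u => -quantile F u) 2 unif := hq.neg
  have hd : 0 < 1 / (lam * quantile F α - c) := one_div_pos.2 (by linarith)
  -- The bounds keep `a` at or above the left end of the flat part, make the jump `1 / (α - a)`
  -- large enough, and, through `α / 2`, keep `a₀` positive.
  refine ⟨hαc, max (max (cdf F (c / lam)) (α - 1 / (lam * quantile F α - c))) (α / 2),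
    ⟨lt_max_of_lt_right (by linarith [hα.1]), max_lt (max_lt hz (by linarith)) (by linarith [hα.1])⟩,
    ?_⟩
  intro a ha
  have ha1 := (le_max_left _ _).trans ((le_max_left _ _).trans ha.1)
  have ha2 := (le_max_right _ _).trans ((le_max_left _ _).trans ha.1)
  refine ⟨cdf_nonneg F _, ha1, ha.2.le, le_rfl, hbefore, hafter, ?_,
    fun u _ h h' => absurd h (not_lt.2 h'), ?_⟩
  · intro u hu _ huα
    have h2 := mul_le_mul_of_nonneg_left (monotoneOn_quantile (G := F) hu hα huα) hlam.le
    have h3 : lam * quantile F α - c ≤ 1 / (α - a) := by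
      rw [le_one_div (by linarith) (sub_pos.2 ha.2)]
      linarith
    linarith
  · rw [integral_excess_eq (A := Iic α) hnq (cdf_nonneg F _) hz.le hα.2.le (fun u _ hu => hu.2)
      (fun u hu hI => by linarith [hafter u hu hI.1 hI.2])
      (fun u hu hA hI => by linarith [hbefore u hu (not_lt.1 fun h' => hI ⟨h', hA⟩)]),
      intervalIntegral.integral_neg] at h1
    rw [div_self (sub_ne_zero.2 ha.2.ne')]
    linarith

lemma ae_eventually_mem_Iic_iff :
    ∀ᵐ u ∂unif, ∀ᶠ n : ℕ in atTop, (u ∈ Iic (α + 1 / ((n : ℝ) + 1)) ↔ u ∈ Iic α) := by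
  refine ae_of_all _ fun u => ?_
  rcases le_or_gt u α with h | h
  · refine Eventually.of_forall fun n => ?_
    have : (0 : ℝ) < 1 / ((n : ℝ) + 1) := by positivity
    simp only [mem_Iic]
    constructor <;> intro <;> linarith
  · have ht : Tendsto (fun n : ℕ => α + 1 / ((n : ℝ) + 1)) atTop (𝓝 (α + 0)) :=
      tendsto_const_nhds.add tendsto_one_div_add_atTop_nhds_zero_nat
    rw [add_zero] at ht
    filter_upwards [ht.eventually_lt_const h] with n hn
    simp only [mem_Iic]
    constructor <;> intro <;> linarith

end BestCase

/-! ### Assembly of the worst and best cases. -/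

section Bounds

variable {F : Measure ℝ} {μF σF μ σ ε R α : ℝ}

/-- The bound on `ε` in terms of the correlation with the indicator of the upper tail. -/
lemma covariance_indicator_lt (hσF_pos : 0 < σF) (hσ : 0 < σ)
    (hα : α ∈ Ioo (0 : ℝ) 1) (hqv : Var[quantile F; unif] = σF ^ 2)
    (hR : 2 * (R * σ) = (μF - μ) ^ 2 + σF ^ 2 + σ ^ 2 - ε)
    (hε : ε < (μF - μ) ^ 2 + (σF - σ) ^ 2 + 2 * σ * σF *
      (1 - corrU (quantile F) ((Ioo α 1).indicator fun _ => (1 : ℝ)))) :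
    cov[(Ioi α).indicator fun _ => (1 : ℝ), quantile F; unif] <
      R * √Var[(Ioi α).indicator fun _ => (1 : ℝ); unif] := by
  have hs := Real.sqrt_pos.2 (variance_indicator_pos hα)
  rw [corrU, stdU, stdU, hqv, Real.sqrt_sq hσF_pos.le, variance_congr indicator_Ioo_ae_eq,
    covariance_comm, covariance_congr_left indicator_Ioo_ae_eq] at hε
  rw [← div_lt_iff₀ hs]
  set s := √Var[(Ioi α).indicator fun _ => (1 : ℝ); unif]
  set C := cov[(Ioi α).indicator fun _ => (1 : ℝ), quantile F; unif]
  have h1 : 2 * σ * σF * (1 - C / (σF * s)) = 2 * σ * σF - 2 * σ * (C / s) := by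
    field_simp
  rw [h1] at hε
  have h2 : 2 * σ * (C / s) < 2 * σ * R := by linarith
  exact lt_of_mul_lt_mul_left h2 (by positivity)

variable [IsProbabilityMeasure F]

/-- The worst case of `VaR⁺_α` and `VaR_α` over the uncertainty set. -/
theorem exists_worst_case (hF : MemLp id 2 F) (hμF : ∫ x, x ∂F = μF)
    (hσF : ∫ x, x ^ 2 ∂F = μF ^ 2 + σF ^ 2) (hσF_pos : 0 < σF) (hσ : 0 < σ)
    (hα : α ∈ Ioo (0 : ℝ) 1) (hε : 0 ≤ ε)
    (hR : 2 * (R * σ) = (μF - μ) ^ 2 + σF ^ 2 + σ ^ 2 - ε) (hR1 : R < σF)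
    (hR2 : cov[(Ioi α).indicator fun _ => (1 : ℝ), quantile F; unif] <
      R * √Var[(Ioi α).indicator fun _ => (1 : ℝ); unif]) :
    ∃ G ∈ uncertaintySet F μ σ ε, ∃ lam > 0, ∃ w₁ c : ℝ,
      (∃ β₀ > α, ∀ β ∈ Ioc α β₀,
        IsRVaRWorstParams (quantile F) α β lam α w₁ c ∧
        ∀ u ∈ Ioo (0 : ℝ) 1, quantile G u =
          hUp μ σ (rvarWorst (quantile F) α β lam α w₁ c) u) ∧
      dW F G = √ε ∧
      (∀ lam' > 0, ∀ β' > α, ∀ w₁' c' : ℝ,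
        IsRVaRWorstParams (quantile F) α β' lam' α w₁' c' →
        ∀ G' : Measure ℝ, IsProbabilityMeasure G' →
        (∀ u ∈ Ioo (0 : ℝ) 1, quantile G' u =
          hUp μ σ (rvarWorst (quantile F) α β' lam' α w₁' c') u) →
        dW F G' = √ε → lam' = lam) ∧
      IsGreatest (VaRPlus α '' uncertaintySet F μ σ ε) (VaRPlus α G) ∧
      (∀ G' ∈ uncertaintySet F μ σ ε, VaRPlus α G' = VaRPlus α G → G' = G) ∧
      IsLUB (VaR α '' uncertaintySet F μ σ ε) (VaRPlus α G) ∧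
      VaRPlus α G ∉ VaR α '' uncertaintySet F μ σ ε := by
  obtain ⟨hq, -, hqv⟩ := quantile_moments hF hμF hσF
  have hsd : √Var[quantile F; unif] = σF := by rw [hqv, Real.sqrt_sq hσF_pos.le]
  have hm : ∀ᵐ u ∂unif, u ∈ Ioi α → quantile F α ≤ quantile F u :=
    ae_unif_mem.mono fun u hu h => monotoneOn_quantile hα hu (le_of_lt h)
  have hm' : ∀ᵐ u ∂unif, u ∉ Ioi α → quantile F u ≤ quantile F α :=
    ae_unif_mem.mono fun u hu h => monotoneOn_quantile hu hα (not_lt.1 h)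
  have hA' : ∃ᵐ u ∂unif, u ∉ Ioi α := (frequently_unif_le hα).mono fun u hu => not_lt.2 hu
  obtain ⟨lam, c, hopt, happ⟩ := exists_isOptimalLift hq measurableSet_Ioi hm hm' hA'
    (by rw [hqv]; positivity) (by rwa [hsd]) hR2
  have hK : MemLp (lifted (quantile F) (Ioi α) lam c) 2 unif := memLp_lifted hq measurableSet_Ioi
  have hs0 := Real.sqrt_pos.2 hopt.variance_pos
  obtain ⟨hw, hαc, β₀, hβ₀, hpar⟩ := isRVaRWorstParams_cdf hq hα hopt.pos hopt.integral_excess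
  have hpar₀ := hpar β₀ ⟨hβ₀, le_rfl⟩
  set K := lifted (quantile F) (Ioi α) lam c with hKdef
  set E := ∫ u, K u ∂unif with hE
  set s := √Var[K; unif] with hs
  let h : ℝ → ℝ := fun u => μ + σ * ((K u - E) / s)
  obtain ⟨h1, h2, h3, h4⟩ := standardise_moments (p := quantile F) (g := h) (μ := μ) (σ := σ) hK
    hopt.variance_pos (fun u => rfl)
  have hcov : cov[quantile F, h; unif] = R * σ := by
    rw [h4, hopt.covariance_eq, mul_div_cancel_right₀ _ hs0.ne', mul_comm]
  have hhle : ∀ {x y : ℝ}, x ≤ y → μ + σ * ((x - E) / s) ≤ μ + σ * ((y - E) / s) :=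
    fun hxy => by gcongr
  have hhlt : ∀ {x y : ℝ}, x < y → μ + σ * ((x - E) / s) < μ + σ * ((y - E) / s) :=
    fun hxy => by gcongr
  have hmono : MonotoneOn h (Ioo 0 1) := fun u hu v hv huv =>
    hhle (monotoneOn_lifted_quantile hopt.pos.le hu hv huv)
  have hleft : ∀ u ∈ Ioo (0 : ℝ) 1, ∀ y < h u, ∃ v ∈ Ioo 0 u, y < h v := fun u hu y hy => by
    have hy' : E + s * ((y - μ) / σ) < K u := by
      simp only [h] at hy
      field_simp at hy ⊢
      linarith
    obtain ⟨v, hv, hyv⟩ := exists_lt_lifted_quantile hopt.pos hα.1.le hu hy'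
    refine ⟨v, hv, ?_⟩
    have := hhlt hyv
    simp only [h]
    refine lt_of_eq_of_lt ?_ this
    field_simp
    ring
  set G := unif.map h with hG
  have hGprob : IsProbabilityMeasure G := Measure.isProbabilityMeasure_map h1.aemeasurable
  have hGq : ∀ u ∈ Ioo (0 : ℝ) 1, quantile G u = h u := fun u hu => quantile_map hmono hleft hu
  have hGmem : G ∈ uncertaintySet F μ σ ε :=
    map_mem_uncertaintySet hF hμF hσF hR h1 h2 h3 hcov.ge
  have hGae : quantile G =ᵐ[unif] h := ae_unif_mem.mono hGq
  have hV : VaRPlus α G = μ + σ * ((c - E) / s) := by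
    refine le_antisymm ?_ ?_
    · refine quantilePlus_map_le h1.aemeasurable hα.1 hw (cdf_le_one F _) fun u hu huw => hhle ?_
      by_cases huα : α < u
      · rw [hKdef, lifted_of_mem (A := Ioi α) huα]
        exact max_le le_rfl (hpar₀.before_w₁ u hu huα huw)
      · rw [hKdef, lifted_of_notMem (A := Ioi α) huα]
        exact (mul_le_mul_of_nonneg_left (monotoneOn_quantile hu hα (not_lt.1 huα))
          hopt.pos.le).trans hαc.le
    · refine le_quantilePlus hα hα.2 fun u hu huα _ => ?_
      rw [hGq u hu]
      refine hhle ?_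
      rw [hKdef, lifted_of_mem (A := Ioi α) huα]
      exact le_max_left _ _
  have hopt' : ∀ G' ∈ uncertaintySet F μ σ ε, VaRPlus α G' ≤ VaRPlus α G ∧
      (VaRPlus α G' = VaRPlus α G → G' = G) := fun G' hG' => by
    have := hG'.1
    obtain ⟨g1, g2, g3⟩ := quantile_moments hG'.2.1 hG'.2.2.1 hG'.2.2.2.1
    rw [hV]
    refine (le_level_of_le_on hq measurableSet_Ioi hopt.pos.le hopt.integral_excess
      hopt.variance_pos hopt.covariance_eq hσ g1 g2 g3
      (le_covariance_of_mem hF hμF hσF hε hR hG') ?_).imp_right fun himp heq =>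
        eq_map_of_quantile_ae_eq (himp heq)
    filter_upwards [ae_unif_mem] with u hu huα
    exact quantilePlus_le_quantile hα.1 hu.2 huα
  refine ⟨G, hGmem, lam, hopt.pos, cdf F (c / lam), c, ⟨β₀, hβ₀, fun β hβ => ⟨hpar β hβ, ?_⟩⟩,
    ?_, ?_, ⟨mem_image_of_mem _ hGmem, ?_⟩, fun G' hG' => (hopt' G' hG').2, ⟨?_, ?_⟩, ?_⟩
  · intro u hu
    rw [hGq u hu, hUp_rvarWorst (hpar β hβ) hu]
  · rw [dW_eq_sqrt_iff hF hμF hσF hε hR hGmem.2.1 hGmem.2.2.1 hGmem.2.2.2.1, ← hcov,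
      covariance_comm, covariance_congr_left hGae, covariance_comm]
  · intro lam' hlam' β' hβ' w₁' c' hpar' G' hG' hGq' hd
    have hE' := integral_excess_worst hq hα.1.le hβ' hpar'
    have hv' : 0 < Var[lifted (quantile F) (Ioi α) lam' c'; unif] :=
      variance_lifted_pos hq measurableSet_Ioi hlam'.le hm hm' hA' (by rw [hE']; exact one_pos)
    have hae' : ∀ᵐ u ∂unif, quantile G' u = _ := ae_unif_mem.mono fun u hu =>
      (hGq' u hu).trans (hUp_rvarWorst hpar' hu)
    obtain ⟨k1, k2, k3, k4⟩ := standardise_moments (p := quantile F) (μ := μ) (σ := σ)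
      (memLp_lifted hq measurableSet_Ioi) hv' (fun u => rfl)
    obtain ⟨j1, j2, j3⟩ := map_moments k1
    rw [← eq_map_of_quantile_ae_eq hae', k2] at j2 j3
    rw [← eq_map_of_quantile_ae_eq hae'] at j1
    rw [k3] at j3
    rw [dW_eq_sqrt_iff hF hμF hσF hε hR j1 j2 j3, covariance_comm, covariance_congr_left hae',
      covariance_comm, k4, mul_comm, mul_right_cancel_iff_of_pos hσ,
      div_eq_iff (Real.sqrt_pos.2 hv').ne'] at hd
    exact hopt.unique hq measurableSet_Ioi hm hm' hA' hR2 ⟨hlam', hE', hv', hd⟩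
  · rintro _ ⟨G', hG', rfl⟩
    exact (hopt' G' hG').1
  · rintro _ ⟨G', hG', rfl⟩
    exact (quantile_le_quantilePlus hα).trans (hopt' G' hG').1
  -- If `b` were a smaller upper bound, a function lifted on some `Ioi (α - 1 / (n + 1))` would be
  -- admissible with level above `b`, and `VaR` at `α` already sees that level.
  · intro b hb
    by_contra! hlt
    rw [hV] at hlt
    have hlt' : (b - μ) / σ < (c - E) / s := by
      rw [div_lt_iff₀' hσ]
      linarith
    obtain ⟨n, lam', c', hlam', hv', hc', hval⟩ := happ (fun n => Ioi (α - 1 / ((n : ℝ) + 1)))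
      (fun n => measurableSet_Ioi) ae_eventually_mem_Ioi_iff _ hlt'
    have hs' := Real.sqrt_pos.2 hv'
    obtain ⟨k1, k2, k3, k4⟩ := standardise_moments (p := quantile F) (μ := μ) (σ := σ)
      (memLp_lifted hq measurableSet_Ioi) hv' (fun u => rfl)
    have hmem := map_mem_uncertaintySet hF hμF hσF hR k1 k2 k3 (by
      rw [k4, mul_comm]
      exact mul_le_mul_of_nonneg_left ((le_div_iff₀ hs').2 hc') hσ.le)
    have hle := hb (mem_image_of_mem _ hmem)
    have hn : (0 : ℝ) < 1 / ((n : ℝ) + 1) := by positivity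
    have hge := le_quantile_map (v := μ + σ * ((c' -
        ∫ u, lifted (quantile F) (Ioi (α - 1 / ((n : ℝ) + 1))) lam' c' u ∂unif) /
        √Var[lifted (quantile F) (Ioi (α - 1 / ((n : ℝ) + 1))) lam' c'; unif])) k1.aemeasurable hα
      (sub_lt_self α hn) (fun u hu huα => by
        rw [lifted_of_mem (A := Ioi (α - 1 / ((n : ℝ) + 1))) huα]
        gcongr
        exact le_max_left _ _)
    rw [div_lt_iff₀' hσ] at hval
    have := hge.trans hle
    linarith
  -- A law attaining the value also maximises `VaRPlus`, hence is `G`; but `α` is not in `Ioi α`, so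
  -- the quantile of `G` at `α` comes from the unraised value `lam * quantile F α < c`.
  · rintro ⟨G', hG', heq⟩
    have := hG'.1
    have hge : VaRPlus α G ≤ VaRPlus α G' := heq ▸ quantile_le_quantilePlus hα
    have hGG := (hopt' G' hG').2 (le_antisymm (hopt' G' hG').1 hge)
    rw [hGG, hV, VaR, hGq α hα] at heq
    refine absurd heq (hhlt ?_).ne
    rw [hKdef, lifted_of_notMem (A := Ioi α) (lt_irrefl α)]
    exact hαc

/-- The best case of `VaR_α` and `VaR⁺_α` over the uncertainty set. -/
theorem exists_best_case (hF : MemLp id 2 F) (hμF : ∫ x, x ∂F = μF)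
    (hσF : ∫ x, x ^ 2 ∂F = μF ^ 2 + σF ^ 2) (hσF_pos : 0 < σF) (hσ : 0 < σ)
    (hα : α ∈ Ioo (0 : ℝ) 1) (hε : 0 ≤ ε)
    (hR : 2 * (R * σ) = (μF - μ) ^ 2 + σF ^ 2 + σ ^ 2 - ε) (hR1 : R < σF)
    (hR2 : cov[(Ioi α).indicator fun _ => (1 : ℝ), quantile F; unif] <
      R * √Var[(Ioi α).indicator fun _ => (1 : ℝ); unif]) :
    ∃ G ∈ uncertaintySet F μ σ ε, ∃ lam > 0, ∃ z₀ c : ℝ,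
      (∃ a₀ ∈ Ioo 0 α, ∀ a ∈ Ico a₀ α,
        IsRVaRBestParams (quantile F) a α lam z₀ α c ∧
        ∀ u ∈ Ioo (0 : ℝ) 1, quantile G u =
          hDown μ σ (rvarBest (quantile F) a α lam z₀ α c) u) ∧
      dW F G = √ε ∧
      (∀ lam' > 0, ∀ a' ∈ Ioo 0 α, ∀ z₀' c' : ℝ,
        IsRVaRBestParams (quantile F) a' α lam' z₀' α c' →
        ∀ G' : Measure ℝ, IsProbabilityMeasure G' →
        (∀ u ∈ Ioo (0 : ℝ) 1, quantile G' u =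
          hDown μ σ (rvarBest (quantile F) a' α lam' z₀' α c') u) →
        dW F G' = √ε → lam' = lam) ∧
      IsLeast (VaR α '' uncertaintySet F μ σ ε) (VaR α G) ∧
      (∀ G' ∈ uncertaintySet F μ σ ε, VaR α G' = VaR α G → G' = G) ∧
      IsGLB (VaRPlus α '' uncertaintySet F μ σ ε) (VaR α G) ∧
      VaR α G ∉ VaRPlus α '' uncertaintySet F μ σ ε := by
  obtain ⟨hq, -, hqv⟩ := quantile_moments hF hμF hσF
  -- Negation turns an upper bound on `(0, α]` into a lower bound, so the same optimisation applies
  -- with mean `-μ`.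
  set p : ℝ → ℝ := fun u => -quantile F u with hpdef
  have hp : MemLp p 2 unif := hq.neg
  have hpv : Var[p; unif] = σF ^ 2 := by rw [hpdef, variance_fun_neg, hqv]
  have hsd : √Var[p; unif] = σF := by rw [hpv, Real.sqrt_sq hσF_pos.le]
  have hm : ∀ᵐ u ∂unif, u ∈ Iic α → -quantile F α ≤ p u :=
    ae_unif_mem.mono fun u hu h => neg_le_neg (monotoneOn_quantile hu hα h)
  have hm' : ∀ᵐ u ∂unif, u ∉ Iic α → p u ≤ -quantile F α :=
    ae_unif_mem.mono fun u hu h => neg_le_neg (monotoneOn_quantile hα hu (not_le.1 h).le)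
  have hA' : ∃ᵐ u ∂unif, u ∉ Iic α := (frequently_lt_unif hα).mono fun u hu => not_le.2 hu
  have hR3 : cov[(Iic α).indicator fun _ => (1 : ℝ), p; unif] <
      R * √Var[(Iic α).indicator fun _ => (1 : ℝ); unif] := by
    rw [indicator_Iic_eq, variance_const_sub memLp_indicator_Ioi.aestronglyMeasurable,
      covariance_const_sub_left (memLp_indicator_Ioi.integrable one_le_two), hpdef,
      covariance_fun_neg_right, neg_neg]
    exact hR2
  obtain ⟨lam, c₀, hopt, happ⟩ := exists_isOptimalLift hp measurableSet_Iic hm hm' hA'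
    (by rw [hpv]; positivity) (by rwa [hsd]) hR3
  obtain ⟨c, rfl⟩ : ∃ c, c₀ = -c := ⟨-c₀, (neg_neg c₀).symm⟩
  have hK : MemLp (lifted p (Iic α) lam (-c)) 2 unif := memLp_lifted hp measurableSet_Iic
  have hs0 := Real.sqrt_pos.2 hopt.variance_pos
  obtain ⟨hαc, a₀, ha₀, hpar⟩ := isRVaRBestParams_cdf hq hα hopt.pos hopt.integral_excess
  have hpar₀ := hpar a₀ ⟨le_rfl, ha₀.2⟩
  have hcomm : ∀ g : ℝ → ℝ, cov[p, g; unif] = cov[quantile F, fun u => -g u; unif] := fun g => by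
    rw [hpdef, covariance_fun_neg_left, covariance_fun_neg_right]
  set K := lifted p (Iic α) lam (-c) with hKdef
  set E := ∫ u, K u ∂unif with hE
  set s := √Var[K; unif] with hs
  let h : ℝ → ℝ := fun u => -(-μ + σ * ((K u - E) / s))
  obtain ⟨h1, h2, h3, h4⟩ := standardise_moments (p := p) (g := fun u => -h u) (μ := -μ) (σ := σ) hK
    hopt.variance_pos (fun u => neg_neg _)
  have hcov : cov[quantile F, h; unif] = R * σ := by
    rw [hcomm, hopt.covariance_eq, mul_div_cancel_right₀ _ hs0.ne', mul_comm] at h4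
    simpa only [neg_neg] using h4
  rw [integral_neg, neg_inj] at h2
  rw [variance_fun_neg] at h3
  replace h1 : MemLp h 2 unif := by simpa only [Pi.neg_def, neg_neg] using h1.neg
  have hhle : ∀ {x y : ℝ}, x ≤ y → -(-μ + σ * ((y - E) / s)) ≤ -(-μ + σ * ((x - E) / s)) :=
    fun hxy => by gcongr
  have hhlt : ∀ {x y : ℝ}, x < y → -(-μ + σ * ((y - E) / s)) < -(-μ + σ * ((x - E) / s)) :=
    fun hxy => by gcongr
  have hmono : MonotoneOn h (Ioo 0 1) := fun u hu v hv huv =>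
    hhle (antitoneOn_lifted_neg_quantile hopt.pos.le hu hv huv)
  have hleft : ∀ u ∈ Ioo (0 : ℝ) 1, ∀ y < h u, ∃ v ∈ Ioo 0 u, y < h v := fun u hu y hy => by
    have hy' : K u < E + s * ((μ - y) / σ) := by
      simp only [h] at hy
      field_simp at hy ⊢
      linarith
    obtain ⟨v, hv, hyv⟩ := exists_lifted_neg_quantile_lt hopt.pos hu hy'
    refine ⟨v, hv, ?_⟩
    have := hhlt hyv
    simp only [h]
    refine lt_of_eq_of_lt ?_ this
    field_simp
    ring
  set G := unif.map h with hG
  have hGprob : IsProbabilityMeasure G := Measure.isProbabilityMeasure_map h1.aemeasurable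
  have hGq : ∀ u ∈ Ioo (0 : ℝ) 1, quantile G u = h u := fun u hu => quantile_map hmono hleft hu
  have hGmem : G ∈ uncertaintySet F μ σ ε :=
    map_mem_uncertaintySet hF hμF hσF hR h1 h2 h3 hcov.ge
  have hGae : quantile G =ᵐ[unif] h := ae_unif_mem.mono hGq
  have hV : VaR α G = -(-μ + σ * ((-c - E) / s)) := by
    rw [VaR, hGq α hα]
    simp only [h]
    rw [hKdef, lifted_of_mem (A := Iic α) (mem_Iic.2 le_rfl), max_eq_left]
    simp only [hpdef]
    linarith
  have hopt' : ∀ G' ∈ uncertaintySet F μ σ ε, VaR α G ≤ VaR α G' ∧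
      (VaR α G' = VaR α G → G' = G) := fun G' hG' => by
    have := hG'.1
    obtain ⟨g1, g2, g3⟩ := quantile_moments hG'.2.1 hG'.2.2.1 hG'.2.2.2.1
    have g4 := le_covariance_of_mem hF hμF hσF hε hR hG'
    have g5 : ∫ u, -quantile G' u ∂unif = -μ := by rw [integral_neg, g2]
    have g6 : Var[fun u => -quantile G' u; unif] = σ ^ 2 := by rw [variance_fun_neg, g3]
    have g7 : R * σ ≤ cov[p, fun u => -quantile G' u; unif] := by
      rw [hcomm]
      simpa only [neg_neg] using g4
    obtain ⟨i1, i2⟩ := le_level_of_le_on (v := -VaR α G') hp measurableSet_Iic hopt.pos.le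
      hopt.integral_excess hopt.variance_pos hopt.covariance_eq hσ g1.neg g5 g6 g7
      (ae_unif_mem.mono fun u hu huα => neg_le_neg (monotoneOn_quantile hu hα huα))
    rw [hV]
    refine ⟨neg_le.1 i1, fun heq => eq_map_of_quantile_ae_eq ?_⟩
    filter_upwards [i2 (by rw [heq, neg_neg])] with u hu
    exact neg_eq_iff_eq_neg.1 hu
  refine ⟨G, hGmem, lam, hopt.pos, cdf F (c / lam), c, ⟨a₀, ha₀, fun a ha => ⟨hpar a ha, ?_⟩⟩,
    ?_, ?_, ⟨mem_image_of_mem _ hGmem, ?_⟩, fun G' hG' => (hopt' G' hG').2, ⟨?_, ?_⟩, ?_⟩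
  · intro u hu
    rw [hGq u hu, hDown_rvarBest (hpar a ha) hu]
  · rw [dW_eq_sqrt_iff hF hμF hσF hε hR hGmem.2.1 hGmem.2.2.1 hGmem.2.2.2.1, ← hcov,
      covariance_comm, covariance_congr_left hGae, covariance_comm]
  · intro lam' hlam' a' ha' z₀' c' hpar' G' hG' hGq' hd
    have hE' := integral_excess_best hq hα.2.le ha'.2 hpar'
    have hv' : 0 < Var[lifted p (Iic α) lam' (-c'); unif] :=
      variance_lifted_pos hp measurableSet_Iic hlam'.le hm hm' hA' (by rw [hE']; exact one_pos)
    have hae' : ∀ᵐ u ∂unif, quantile G' u = _ := ae_unif_mem.mono fun u hu =>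
      (hGq' u hu).trans (hDown_rvarBest hpar' hu)
    obtain ⟨k1, k2, k3, k4⟩ := standardise_moments (p := p) (μ := -μ) (σ := σ)
      (memLp_lifted hp measurableSet_Iic) hv' (fun u => rfl)
    obtain ⟨j1, j2, j3⟩ := map_moments k1.neg
    simp only [Pi.neg_def] at j1 j2 j3
    rw [← eq_map_of_quantile_ae_eq hae', integral_neg, k2, neg_neg] at j2 j3
    rw [← eq_map_of_quantile_ae_eq hae'] at j1
    rw [variance_fun_neg, k3] at j3
    rw [dW_eq_sqrt_iff hF hμF hσF hε hR j1 j2 j3, covariance_comm, covariance_congr_left hae',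
      covariance_comm, ← hcomm, k4, mul_comm, mul_right_cancel_iff_of_pos hσ,
      div_eq_iff (Real.sqrt_pos.2 hv').ne'] at hd
    exact hopt.unique hp measurableSet_Iic hm hm' hA' hR3 ⟨hlam', hE', hv', hd⟩
  · rintro _ ⟨G', hG', rfl⟩
    exact (hopt' G' hG').1
  · rintro _ ⟨G', hG', rfl⟩
    exact (hopt' G' hG').1.trans (quantile_le_quantilePlus hα)
  · intro b hb
    by_contra! hlt
    rw [hV] at hlt
    have hlt' : (μ - b) / σ < (-c - E) / s := by
      rw [div_lt_iff₀' hσ]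
      linarith
    obtain ⟨n, lam', c', hlam', hv', hc', hval⟩ := happ (fun n => Iic (α + 1 / ((n : ℝ) + 1)))
      (fun n => measurableSet_Iic) ae_eventually_mem_Iic_iff _ hlt'
    have hs' := Real.sqrt_pos.2 hv'
    obtain ⟨k1, k2, k3, k4⟩ := standardise_moments (p := p) (μ := -μ) (σ := σ)
      (memLp_lifted hp measurableSet_Iic) hv' (fun u => rfl)
    have k5 := k1.neg
    simp only [Pi.neg_def] at k5
    have hmem := map_mem_uncertaintySet hF hμF hσF hR k5 (by rw [integral_neg, k2, neg_neg])
      (by rw [variance_fun_neg, k3]) (by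
        rw [← hcomm, k4, mul_comm]
        exact mul_le_mul_of_nonneg_left ((le_div_iff₀ hs').2 hc') hσ.le)
    have hle := hb (mem_image_of_mem _ hmem)
    have hn : (0 : ℝ) < 1 / ((n : ℝ) + 1) := by positivity
    have hge := quantilePlus_map_le (v := -(-μ + σ * ((c' -
        ∫ u, lifted p (Iic (α + 1 / ((n : ℝ) + 1))) lam' c' u ∂unif) /
        √Var[lifted p (Iic (α + 1 / ((n : ℝ) + 1))) lam' c'; unif]))) k5.aemeasurable hα.1
      (lt_min (lt_add_of_pos_right α hn) hα.2) (min_le_right _ _) (fun u hu huα => by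
        rw [lifted_of_mem (A := Iic (α + 1 / ((n : ℝ) + 1))) (huα.trans (min_le_left _ _))]
        gcongr
        exact le_max_left _ _)
    rw [div_lt_iff₀' hσ] at hval
    have := hle.trans hge
    linarith
  · rintro ⟨G', hG', heq⟩
    have := hG'.1
    have hge : VaR α G' ≤ VaR α G := heq ▸ quantile_le_quantilePlus hα
    have hGG := (hopt' G' hG').2 (le_antisymm hge (hopt' G' hG').1)
    rw [hGG] at heq
    -- The minimiser jumps at `α`: to the right its quantile function is at least the unraised value
    -- at `α`, which exceeds the flat value since `c < lam * quantile F α`.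
    have hlow : -(-μ + σ * ((lam * -quantile F α - E) / s)) ≤ VaRPlus α G := by
      refine le_quantilePlus hα hα.2 fun u hu huα _ => ?_
      rw [hGq u hu]
      refine hhle ?_
      rw [hKdef, lifted_of_notMem (A := Iic α) (not_le.2 huα)]
      exact mul_le_mul_of_nonneg_left (neg_le_neg (monotoneOn_quantile hα hu huα.le)) hopt.pos.le
    rw [heq, hV] at hlow
    exact absurd hlow (not_le.2 (hhlt (by linarith)))

end Bounds

end VaRBounds

theorem mainTheorem7
    (F : Measure ℝ) [IsProbabilityMeasure F] (hF : MemLp id 2 F)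
    (μF σF : ℝ) (hμF : ∫ x, x ∂F = μF) (hσF : ∫ x, x ^ 2 ∂F = μF ^ 2 + σF ^ 2) (hσF_pos : 0 < σF)
    (μ σ : ℝ) (hσ : 0 < σ) (α : ℝ) (hα : α ∈ Ioo (0 : ℝ) 1) (ε : ℝ)
    (hε_lower : (μF - μ) ^ 2 + (σF - σ) ^ 2 < ε)
    (hε_upper : ε < (μF - μ) ^ 2 + (σF - σ) ^ 2 + 2 * σ * σF *
      (1 - VaRBounds.corrU (VaRBounds.quantile F) ((Ioo α 1).indicator fun _ => (1 : ℝ)))) :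
    -- worst case
    (∃ G ∈ VaRBounds.uncertaintySet F μ σ ε, ∃ lam > 0, ∃ w₁ c : ℝ,
      -- the quantile function of `G` is the RVaR worst-case quantile with `w₀ = α`
      (∃ β₀ > α, ∀ β ∈ Ioc α β₀,
        VaRBounds.IsRVaRWorstParams (VaRBounds.quantile F) α β lam α w₁ c ∧
        ∀ u ∈ Ioo (0 : ℝ) 1, VaRBounds.quantile G u =
          VaRBounds.hUp μ σ (VaRBounds.rvarWorst (VaRBounds.quantile F) α β lam α w₁ c) u) ∧
      -- `lam` is the unique positive solution of `d_W(F⁻¹, h↑) = √ε`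
      VaRBounds.dW F G = √ε ∧
      (∀ lam' > 0, ∀ β' > α, ∀ w₁' c' : ℝ,
        VaRBounds.IsRVaRWorstParams (VaRBounds.quantile F) α β' lam' α w₁' c' →
        ∀ G' : Measure ℝ, IsProbabilityMeasure G' →
        (∀ u ∈ Ioo (0 : ℝ) 1, VaRBounds.quantile G' u =
          VaRBounds.hUp μ σ (VaRBounds.rvarWorst (VaRBounds.quantile F) α β' lam' α w₁' c') u) →
        VaRBounds.dW F G' = √ε → lam' = lam) ∧
      -- `G` is the unique worst-case distribution of `VaR⁺_α`
      IsGreatest (VaRBounds.VaRPlus α '' VaRBounds.uncertaintySet F μ σ ε)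
        (VaRBounds.VaRPlus α G) ∧
      (∀ G' ∈ VaRBounds.uncertaintySet F μ σ ε,
        VaRBounds.VaRPlus α G' = VaRBounds.VaRPlus α G → G' = G) ∧
      -- the worst-case value of `VaR_α` is the same, but it is not attained
      IsLUB (VaRBounds.VaR α '' VaRBounds.uncertaintySet F μ σ ε) (VaRBounds.VaRPlus α G) ∧
      VaRBounds.VaRPlus α G ∉ VaRBounds.VaR α '' VaRBounds.uncertaintySet F μ σ ε) ∧
    -- best case; the level of `VaR` is the upper level `β` of `RVaR`
    (∃ G ∈ VaRBounds.uncertaintySet F μ σ ε, ∃ lam > 0, ∃ z₀ c : ℝ,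
      -- the quantile function of `G` is the RVaR best-case quantile with `z₁ = β`
      (∃ a₀ ∈ Ioo 0 α, ∀ a ∈ Ico a₀ α,
        VaRBounds.IsRVaRBestParams (VaRBounds.quantile F) a α lam z₀ α c ∧
        ∀ u ∈ Ioo (0 : ℝ) 1, VaRBounds.quantile G u =
          VaRBounds.hDown μ σ (VaRBounds.rvarBest (VaRBounds.quantile F) a α lam z₀ α c) u) ∧
      -- `lam` is the unique positive solution of `d_W(F⁻¹, h↓) = √ε`
      VaRBounds.dW F G = √ε ∧
      (∀ lam' > 0, ∀ a' ∈ Ioo 0 α, ∀ z₀' c' : ℝ,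
        VaRBounds.IsRVaRBestParams (VaRBounds.quantile F) a' α lam' z₀' α c' →
        ∀ G' : Measure ℝ, IsProbabilityMeasure G' →
        (∀ u ∈ Ioo (0 : ℝ) 1, VaRBounds.quantile G' u =
          VaRBounds.hDown μ σ (VaRBounds.rvarBest (VaRBounds.quantile F) a' α lam' z₀' α c') u) →
        VaRBounds.dW F G' = √ε → lam' = lam) ∧
      -- `G` is the unique best-case distribution of `VaR_α`
      IsLeast (VaRBounds.VaR α '' VaRBounds.uncertaintySet F μ σ ε) (VaRBounds.VaR α G) ∧
      (∀ G' ∈ VaRBounds.uncertaintySet F μ σ ε,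
        VaRBounds.VaR α G' = VaRBounds.VaR α G → G' = G) ∧
      -- the best-case value of `VaR⁺_α` is the same, but it is not attained
      IsGLB (VaRBounds.VaRPlus α '' VaRBounds.uncertaintySet F μ σ ε) (VaRBounds.VaR α G) ∧
      VaRBounds.VaR α G ∉ VaRBounds.VaRPlus α '' VaRBounds.uncertaintySet F μ σ ε) := by
  set c₀ := VaRBounds.corrU (VaRBounds.quantile F) ((Ioo α 1).indicator fun _ => (1 : ℝ))
  have hε : 0 ≤ ε := le_trans (by positivity) hε_lower.le
  -- `R * σ` is the least covariance with the quantile function of `F` that the ball allows.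
  obtain ⟨R, hR⟩ : ∃ R, 2 * (R * σ) = (μF - μ) ^ 2 + σF ^ 2 + σ ^ 2 - ε :=
    ⟨((μF - μ) ^ 2 + σF ^ 2 + σ ^ 2 - ε) / (2 * σ), by field_simp⟩
  have hR1 : R < σF := lt_of_mul_lt_mul_right (by linarith : R * σ < σF * σ) hσ.le
  have hR2 := VaRBounds.covariance_indicator_lt hσF_pos hσ hα
    (VaRBounds.quantile_moments hF hμF hσF).2.2 hR hε_upper
  exact ⟨VaRBounds.exists_worst_case hF hμF hσF hσF_pos hσ hα hε hR hR1 hR2,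
    VaRBounds.exists_best_case hF hμF hσF hσF_pos hσ hα hε hR hR1 hR2⟩
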